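/- Let $n\ge 3$ and let $(M,g,J,D)$ be a Kähler manifold of real dimension $2n$ ($J$ an orthogonal almost complex structure with $\bar\nabla J=0$) with a smooth $J$-invariant distribution $D$ of real codimension $2$. For $p\in M$ let $\xi$ be a unit vector of $D(p)^\perp$, so that $D(p)^{\perp}=\mathrm{span}\{\xi,J\xi\}$, and put $\eta=g(\xi,\cdot)$, $\tilde\eta=g(J\xi,\cdot)$. Put $\bar R(X,Y,Z,U)=g(\bar\nabla_X\bar\nabla_YZ-\bar\nabla_Y\bar\nabla_XZ-\bar\nabla_{[X,Y]}Z,U)$. Assume that $M$ is a QCH-manifold: for a unit vector $X\in T_pM$, the holomorphic sectional curvature $\bar R(X,JX,JX,X)$ depends only on $p$ and on the angle $\varphi\in[0,\pi/2]$ between $\mathrm{span}\{X,JX\}$ and $\mathrm{span}\{\xi,J\xi\}$ (so $\cos^2\varphi=\eta(X)^2+\tilde\eta(X)^2$). Then there are functions $a,b,c$ on $M$ with $\bar R=a\pi+b\Phi+c\Psi$, where, with $\sigma(X,Y)=\eta(X)\eta(Y)+\tilde\eta(X)\tilde\eta(Y)$ and $\omega(X,Y)=\eta(X)\tilde\eta(Y)-\eta(Y)\tilde\eta(X)$,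 $$\begin{aligned} 4\pi(X,Y,Z,U)={}&g(Y,Z)g(X,U)-g(X,Z)g(Y,U)+g(JY,Z)g(JX,U)\\&-g(JX,Z)g(JY,U)-2g(JX,Y)g(JZ,U),\\ 8\Phi(X,Y,Z,U)={}&g(Y,Z)\sigma(X,U)-g(X,Z)\sigma(Y,U)+g(X,U)\sigma(Y,Z)-g(Y,U)\sigma(X,Z)\\ &+g(JY,Z)\omega(X,U)-g(JX,Z)\omega(Y,U)+g(JX,U)\omega(Y,Z)-g(JY,U)\omega(X,Z)\\ &-2g(JX,Y)\omega(Z,U)-2g(JZ,U)\omega(X,Y),\\ \Psi(X,Y,Z,U)={}&-\omega(X,Y)\,\omega(Z,U). \end{aligned}$$ Let $a,b,c$ be any such functions, and let $N$ be a Lagrangian submanifold of $M$ of real dimension $n$ ($J$ maps the tangent spaces of $N$ to normal spaces), possibly immersed, with the induced metric, scalar curvature $\tau=\sum_{i<j}K(e_i\wedge e_j)$ ($e_1,\dots,e_n$ an orthonormal basis of the tangent space), Ricci curvature $Ric$, second fundamental form $h$ and mean curvature vector $H=\frac1n\sum_i h(e_i,e_i)$. Let $q\in N$ and let $$\delta_n=\tau-\frac1{n-1}\min_{Y\in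 T_qN,\ \|Y\|=1}Ric(Y)$$ be Oprea's invariant at $q$. This minimum is attained, and for every unit vector $X\in T_qN$ at which it is attained, $$\begin{aligned} \delta_n\le{}&\frac{(n-2)(n+1)}{8}\,a+\frac{n-2}{8(n-1)}\bigl\{n-[\eta(X)^2+\tilde\eta(X)^2]\bigr\}\,b\\ &+\Bigl[\|\eta^\top\|^2\|\tilde\eta^\top\|^2-g(\eta^\top,\tilde\eta^\top)^2-\frac1{n-1}\bigl\|\eta(X)\tilde\eta^\top-\tilde\eta(X)\eta^\top\bigr\|^2\Bigr]c\\ &+\frac{(3n-1)(n-2)n^2}{2(n-1)(3n+5)}\,\|H\|^2 , \end{aligned}$$ where $\eta^\top,\tilde\eta^\top$ are the restrictions of $\eta,\tilde\eta$ to $T_qN$, and $a,b,c,\eta,\tilde\eta,H$ are taken at $q$. -/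

import Mathlib

open scoped Manifold ContDiff Topology

noncomputable section

namespace QCH

/-! ### Levi-Civita connection and curvature in local coordinates

`G : E → E →L[ℝ] E →L[ℝ] ℝ` is the matrix of a metric in a coordinate domain of the vector
space `E`, i.e. `G y v w` is the scalar product at `y` of the vectors with components `v`, `w`. -/

section Coordinates

variable {E : Type*} [NormedAddCommGroup E] [NormedSpace ℝ E]

/-- The Christoffel symbols `Γ_y(v, w)` of the Levi-Civita connection of `G`: the vector with
`2 G_y(Γ_y(v, w), z) = (∂_v G)_y(w, z) + (∂_w G)_y(v, z) - (∂_z G)_y(v, w)` for all `z`. In the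
coordinates, `∇_V W = ∂_V W + Γ(V, W)`. -/
def christoffel (G : E → E →L[ℝ] E →L[ℝ] ℝ) (y v w : E) : E :=
  (G y).inverse ((1 / 2 : ℝ) •
    (fderiv ℝ G y v w + fderiv ℝ G y w v - ((fderiv ℝ G y).flip v).flip w))

/-- The curvature `R(u, v) w = ∇_u ∇_v w - ∇_v ∇_u w` (`u`, `v`, `w` extended by constant
components, so that `[u, v] = 0`). -/
def coordCurvature (G : E → E →L[ℝ] E →L[ℝ] ℝ) (y u v w : E) : E :=
  fderiv ℝ (fun y' ↦ christoffel G y' v w) y u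
    - fderiv ℝ (fun y' ↦ christoffel G y' u w) y v
    + christoffel G y u (christoffel G y v w) - christoffel G y v (christoffel G y u w)

end Coordinates

/-! ### Tensors on a manifold and their components in charts -/

section Manifold

variable {E : Type*} [NormedAddCommGroup E] [NormedSpace ℝ E]
  {M : Type*} [TopologicalSpace M] [ChartedSpace E M]

/-- The differential at `x` of the chart around `p`. -/
def dChart (p x : M) : TangentSpace 𝓘(ℝ, E) x →L[ℝ] E :=
  mfderiv 𝓘(ℝ, E) 𝓘(ℝ, E) (extChartAt 𝓘(ℝ, E) p) x

/-- The differential at `y` of the inverse of the chart around `p`; it sends the `i`-th basis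
vector to the coordinate vector field `∂_i`. -/
def dChartSymm (p : M) (y : E) :
    E →L[ℝ] TangentSpace 𝓘(ℝ, E) ((extChartAt 𝓘(ℝ, E) p).symm y) :=
  mfderiv 𝓘(ℝ, E) 𝓘(ℝ, E) (extChartAt 𝓘(ℝ, E) p).symm y

/-- The components `y ↦ g_y(∂_v, ∂_w)` of a field of bilinear forms in the chart around `p`. -/
def coordMetric
    (g : ∀ x : M, TangentSpace 𝓘(ℝ, E) x →L[ℝ] TangentSpace 𝓘(ℝ, E) x →L[ℝ] ℝ) (p : M) (y : E) :
    E →L[ℝ] E →L[ℝ] ℝ :=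
  (ContinuousLinearMap.precomp ℝ (dChartSymm p y)).comp
    ((g ((extChartAt 𝓘(ℝ, E) p).symm y)).comp (dChartSymm p y))

/-- The components of a field of endomorphisms of the tangent spaces in the chart around `p`. -/
def coordEndo (J : ∀ x : M, TangentSpace 𝓘(ℝ, E) x →L[ℝ] TangentSpace 𝓘(ℝ, E) x)
    (p : M) (y : E) : E →L[ℝ] E :=
  (dChart p ((extChartAt 𝓘(ℝ, E) p).symm y)).comp
    ((J ((extChartAt 𝓘(ℝ, E) p).symm y)).comp (dChartSymm p y))

/-- The Riemannian curvature tensor `R(X, Y, Z, U) = g(R(X, Y) Z, U)` at `p`. -/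
def riemann
    (g : ∀ x : M, TangentSpace 𝓘(ℝ, E) x →L[ℝ] TangentSpace 𝓘(ℝ, E) x →L[ℝ] ℝ) (p : M)
    (X Y Z U : TangentSpace 𝓘(ℝ, E) p) : ℝ :=
  coordMetric g p (extChartAt 𝓘(ℝ, E) p p)
    (coordCurvature (coordMetric g p) (extChartAt 𝓘(ℝ, E) p p)
      (dChart p p X) (dChart p p Y) (dChart p p Z))
    (dChart p p U)

/-- Orthonormal families of tangent vectors at `p`. -/
def IsOrthonormal
    (g : ∀ x : M, TangentSpace 𝓘(ℝ, E) x →L[ℝ] TangentSpace 𝓘(ℝ, E) x →L[ℝ] ℝ) (p : M)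
    {k : ℕ} (e : Fin k → TangentSpace 𝓘(ℝ, E) p) : Prop :=
  ∀ i j, g p (e i) (e j) = if i = j then 1 else 0

/-- The scalar curvature `τ(p) = ∑_{i < j} K(e_i ∧ e_j)`, `K(e_i ∧ e_j) = R(e_i, e_j, e_j, e_i)`,
computed in an orthonormal basis `e` of the tangent space at `p`. -/
def scalarCurvature
    (g : ∀ x : M, TangentSpace 𝓘(ℝ, E) x →L[ℝ] TangentSpace 𝓘(ℝ, E) x →L[ℝ] ℝ) (p : M)
    {m : ℕ} (e : Fin m → TangentSpace 𝓘(ℝ, E) p) : ℝ :=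
  ∑ i, ∑ j, if i < j then riemann g p (e i) (e j) (e j) (e i) else 0

/-- The Ricci curvature `Ric_L(X) = ∑_i R(X, l_i, l_i, X)` at `X ∈ L` of the subspace `L` of the
tangent space with orthonormal basis `l`. If `X = l_1`, this is `∑_{i ≥ 2} K(l_1 ∧ l_i)`. For an
orthonormal basis `l` of the whole tangent space it is the Ricci curvature `Ric(X)`. -/
def ricci
    (g : ∀ x : M, TangentSpace 𝓘(ℝ, E) x →L[ℝ] TangentSpace 𝓘(ℝ, E) x →L[ℝ] ℝ) (p : M)
    {k : ℕ} (l : Fin k → TangentSpace 𝓘(ℝ, E) p) (X : TangentSpace 𝓘(ℝ, E) p) : ℝ :=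
  ∑ i, riemann g p X (l i) (l i) X

/-- Oprea's invariant `δ_k = τ - (1 / (k - 1)) min Ric_L(X)` at `p`, the minimum being over the
`k`-dimensional subspaces `L` of the tangent space (`L` is given by an orthonormal basis `l`) and
the unit vectors `X ∈ L`; `e` is an orthonormal basis of the tangent space. -/
def opreaDelta
    (g : ∀ x : M, TangentSpace 𝓘(ℝ, E) x →L[ℝ] TangentSpace 𝓘(ℝ, E) x →L[ℝ] ℝ) (p : M)
    {m : ℕ} (e : Fin m → TangentSpace 𝓘(ℝ, E) p) (k : ℕ) : ℝ :=
  scalarCurvature g p e - 1 / ((k : ℝ) - 1) *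
    sInf {r : ℝ | ∃ l : Fin k → TangentSpace 𝓘(ℝ, E) p, IsOrthonormal g p l ∧
      ∃ X ∈ Submodule.span ℝ (Set.range l), g p X X = 1 ∧ r = ricci g p l X}

/-! ### Kähler manifolds with a `J`-invariant distribution of codimension 2 -/

section Kaehler

variable [IsManifold 𝓘(ℝ, E) ∞ M]

/-- `(M, g, J)` is a Kähler manifold: `J` is a smooth almost complex structure, orthogonal with
respect to `g` and parallel for the Levi-Civita connection, `∇J = 0`. -/
structure IsKaehler
    (g : Bundle.ContMDiffRiemannianMetric 𝓘(ℝ, E) ∞ E (fun x : M ↦ TangentSpace 𝓘(ℝ, E) x))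
    (J : ∀ x : M, TangentSpace 𝓘(ℝ, E) x →L[ℝ] TangentSpace 𝓘(ℝ, E) x) : Prop where
  smooth : ContMDiff 𝓘(ℝ, E) (𝓘(ℝ, E).prod 𝓘(ℝ, E →L[ℝ] E)) ∞
    (fun x ↦ Bundle.TotalSpace.mk' (E →L[ℝ] E)
      (E := fun x : M ↦ TangentSpace 𝓘(ℝ, E) x →L[ℝ] TangentSpace 𝓘(ℝ, E) x) x (J x))
  sq : ∀ (x : M) (v : TangentSpace 𝓘(ℝ, E) x), J x (J x v) = -v
  orthogonal : ∀ (x : M) (v w : TangentSpace 𝓘(ℝ, E) x),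
    g.inner x (J x v) (J x w) = g.inner x v w
  /-- `(∇_v J) w = ∇_v (J w) - J (∇_v w) = 0`, in every chart. -/
  parallel : ∀ (p : M), ∀ y ∈ (extChartAt 𝓘(ℝ, E) p).target, ∀ v w : E,
    fderiv ℝ (coordEndo J p) y v w
      + christoffel (coordMetric g.inner p) y v (coordEndo J p y w)
      - coordEndo J p y (christoffel (coordMetric g.inner p) y v w) = 0

/-- `ξ` is a unit vector at `p` orthogonal to `D`. When `D(p)` is `J`-invariant of codimension 2,
this means that `ξ, Jξ` is an orthonormal basis of `D(p)^⊥`. -/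
def IsUnitNormal
    (g : Bundle.ContMDiffRiemannianMetric 𝓘(ℝ, E) ∞ E (fun x : M ↦ TangentSpace 𝓘(ℝ, E) x))
    (D : ∀ x : M, Submodule ℝ (TangentSpace 𝓘(ℝ, E) x)) (p : M)
    (ξ : TangentSpace 𝓘(ℝ, E) p) : Prop :=
  g.inner p ξ ξ = 1 ∧ ∀ v ∈ D p, g.inner p ξ v = 0

/-- `D` is a smooth `J`-invariant distribution of (real) codimension 2. It is smooth in the sense
that its orthogonal complement is locally spanned by `ξ, Jξ` for a smooth unit vector field `ξ`. -/
structure IsHolomorphicDistribution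
    (g : Bundle.ContMDiffRiemannianMetric 𝓘(ℝ, E) ∞ E (fun x : M ↦ TangentSpace 𝓘(ℝ, E) x))
    (J : ∀ x : M, TangentSpace 𝓘(ℝ, E) x →L[ℝ] TangentSpace 𝓘(ℝ, E) x)
    (D : ∀ x : M, Submodule ℝ (TangentSpace 𝓘(ℝ, E) x)) : Prop where
  codim : ∀ x, Module.finrank ℝ (D x) + 2 = Module.finrank ℝ (TangentSpace 𝓘(ℝ, E) x)
  invariant : ∀ x, ∀ v ∈ D x, J x v ∈ D x
  smooth : ∀ p : M, ∃ ξ : ∀ x : M, TangentSpace 𝓘(ℝ, E) x, ∃ U ∈ 𝓝 p,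
    ContMDiffOn 𝓘(ℝ, E) 𝓘(ℝ, E).tangent ∞ (fun x ↦ (⟨x, ξ x⟩ : TangentBundle 𝓘(ℝ, E) M)) U ∧
      ∀ x ∈ U, IsUnitNormal g D x (ξ x)

/-- The 1-form `η = g(ξ, ·)`; `η̃` is the 1-form `eta g (J ξ)`. -/
def eta (g : Bundle.ContMDiffRiemannianMetric 𝓘(ℝ, E) ∞ E (fun x : M ↦ TangentSpace 𝓘(ℝ, E) x))
    {p : M} (ξ X : TangentSpace 𝓘(ℝ, E) p) : ℝ :=
  g.inner p ξ X

/-- The angle in `[0, π/2]` between the holomorphic planes `span{X, JX}` (`X` a unit vector) and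
`span{ξ, Jξ}`: its cosine is the length of the orthogonal projection of `X` to `span{ξ, Jξ}`. (The
two planes being `J`-invariant, every unit vector of `span{X, JX}` gives the same value.) -/
def holomorphicAngle
    (g : Bundle.ContMDiffRiemannianMetric 𝓘(ℝ, E) ∞ E (fun x : M ↦ TangentSpace 𝓘(ℝ, E) x))
    (J : ∀ x : M, TangentSpace 𝓘(ℝ, E) x →L[ℝ] TangentSpace 𝓘(ℝ, E) x)
    {p : M} (ξ X : TangentSpace 𝓘(ℝ, E) p) : ℝ :=
  Real.arccos (√(eta g ξ X ^ 2 + eta g (J p ξ) X ^ 2))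

/-- Quasi-constant holomorphic sectional curvatures: the sectional curvature of `span{X, JX}`
depends only on the point and on the angle between `span{X, JX}` and the orthogonal complement
of `D`. -/
def IsQCH
    (g : Bundle.ContMDiffRiemannianMetric 𝓘(ℝ, E) ∞ E (fun x : M ↦ TangentSpace 𝓘(ℝ, E) x))
    (J : ∀ x : M, TangentSpace 𝓘(ℝ, E) x →L[ℝ] TangentSpace 𝓘(ℝ, E) x)
    (D : ∀ x : M, Submodule ℝ (TangentSpace 𝓘(ℝ, E) x)) : Prop :=
  ∃ F : M → ℝ → ℝ, ∀ (p : M) (ξ X : TangentSpace 𝓘(ℝ, E) p),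
    IsUnitNormal g D p ξ → g.inner p X X = 1 →
      riemann g.inner p X (J p X) (J p X) X = F p (holomorphicAngle g J ξ X)

/-- The tensor `π`. -/
def piTensor
    (g : Bundle.ContMDiffRiemannianMetric 𝓘(ℝ, E) ∞ E (fun x : M ↦ TangentSpace 𝓘(ℝ, E) x))
    (J : ∀ x : M, TangentSpace 𝓘(ℝ, E) x →L[ℝ] TangentSpace 𝓘(ℝ, E) x)
    {p : M} (X Y Z U : TangentSpace 𝓘(ℝ, E) p) : ℝ :=
  1 / 4 * (g.inner p Y Z * g.inner p X U - g.inner p X Z * g.inner p Y U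
    + g.inner p (J p Y) Z * g.inner p (J p X) U - g.inner p (J p X) Z * g.inner p (J p Y) U
    - 2 * (g.inner p (J p X) Y * g.inner p (J p Z) U))

/-- The tensor `Φ`. -/
def phiTensor
    (g : Bundle.ContMDiffRiemannianMetric 𝓘(ℝ, E) ∞ E (fun x : M ↦ TangentSpace 𝓘(ℝ, E) x))
    (J : ∀ x : M, TangentSpace 𝓘(ℝ, E) x →L[ℝ] TangentSpace 𝓘(ℝ, E) x)
    {p : M} (ξ X Y Z U : TangentSpace 𝓘(ℝ, E) p) : ℝ :=
  let η := eta g ξ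
  let η' := eta g (J p ξ)
  1 / 8 * (g.inner p Y Z * (η X * η U + η' X * η' U) - g.inner p X Z * (η Y * η U + η' Y * η' U)
    + g.inner p X U * (η Y * η Z + η' Y * η' Z) - g.inner p Y U * (η X * η Z + η' X * η' Z)
    + g.inner p (J p Y) Z * (η X * η' U - η U * η' X)
    - g.inner p (J p X) Z * (η Y * η' U - η U * η' Y)
    + g.inner p (J p X) U * (η Y * η' Z - η Z * η' Y)
    - g.inner p (J p Y) U * (η X * η' Z - η Z * η' X)
    - 2 * (g.inner p (J p X) Y * (η Z * η' U - η U * η' Z))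
    - 2 * (g.inner p (J p Z) U * (η X * η' Y - η Y * η' X)))

/-- The tensor `Ψ`. -/
def psiTensor
    (g : Bundle.ContMDiffRiemannianMetric 𝓘(ℝ, E) ∞ E (fun x : M ↦ TangentSpace 𝓘(ℝ, E) x))
    (J : ∀ x : M, TangentSpace 𝓘(ℝ, E) x →L[ℝ] TangentSpace 𝓘(ℝ, E) x)
    {p : M} (ξ X Y Z U : TangentSpace 𝓘(ℝ, E) p) : ℝ :=
  let η := eta g ξ
  let η' := eta g (J p ξ)
  η Y * η Z * (η' X * η' U) - η X * η Z * (η' Y * η' U)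
    + η X * η U * (η' Y * η' Z) - η Y * η U * (η' X * η' Z)

/-- The curvature identity `R = a π + b Φ + c Ψ` with functions `a`, `b`, `c` on `M`. -/
def HasCurvatureFunctions
    (g : Bundle.ContMDiffRiemannianMetric 𝓘(ℝ, E) ∞ E (fun x : M ↦ TangentSpace 𝓘(ℝ, E) x))
    (J : ∀ x : M, TangentSpace 𝓘(ℝ, E) x →L[ℝ] TangentSpace 𝓘(ℝ, E) x)
    (D : ∀ x : M, Submodule ℝ (TangentSpace 𝓘(ℝ, E) x)) (a b c : M → ℝ) : Prop :=
  ∀ (p : M) (ξ : TangentSpace 𝓘(ℝ, E) p), IsUnitNormal g D p ξ →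
    ∀ X Y Z U : TangentSpace 𝓘(ℝ, E) p,
      riemann g.inner p X Y Z U =
        a p * piTensor g J X Y Z U + b p * phiTensor g J ξ X Y Z U
          + c p * psiTensor g J ξ X Y Z U

end Kaehler

end Manifold

/-! ### Submanifolds -/

section Submanifold

variable {E : Type*} [NormedAddCommGroup E] [NormedSpace ℝ E]
  {M : Type*} [TopologicalSpace M] [ChartedSpace E M]
  {E' : Type*} [NormedAddCommGroup E'] [NormedSpace ℝ E']
  {N : Type*} [TopologicalSpace N] [ChartedSpace E' N]

/-- The metric induced on `N` by a map `f : N → M`. -/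
def inducedMetric
    (g : ∀ x : M, TangentSpace 𝓘(ℝ, E) x →L[ℝ] TangentSpace 𝓘(ℝ, E) x →L[ℝ] ℝ) (f : N → M)
    (q : N) : TangentSpace 𝓘(ℝ, E') q →L[ℝ] TangentSpace 𝓘(ℝ, E') q →L[ℝ] ℝ :=
  (ContinuousLinearMap.precomp ℝ (mfderiv 𝓘(ℝ, E') 𝓘(ℝ, E) f q)).comp
    ((g (f q)).comp (mfderiv 𝓘(ℝ, E') 𝓘(ℝ, E) f q))

/-- The second fundamental form `h(X, Y) = ∇̄_X Y - ∇_X Y` of an immersion `f` at `q`, `∇̄` and `∇`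
being the Levi-Civita connections of `g` and of the induced metric. If `φ` is the map `f` in the
charts around `q` and `f q`, its components are
`∂_u ∂_v φ + Γ̄(∂_u φ, ∂_v φ) - dφ(Γ(u, v))`. -/
def secondFundamentalForm
    (g : ∀ x : M, TangentSpace 𝓘(ℝ, E) x →L[ℝ] TangentSpace 𝓘(ℝ, E) x →L[ℝ] ℝ) (f : N → M)
    (q : N) (X Y : TangentSpace 𝓘(ℝ, E') q) : TangentSpace 𝓘(ℝ, E) (f q) :=
  let φ : E' → E := writtenInExtChartAt 𝓘(ℝ, E') 𝓘(ℝ, E) q f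
  let z : E' := extChartAt 𝓘(ℝ, E') q q
  let u : E' := dChart q q X
  let v : E' := dChart q q Y
  (dChart (E := E) (f q) (f q)).inverse
    (fderiv ℝ (fderiv ℝ φ) z u v
      + christoffel (coordMetric g (f q)) (φ z) (fderiv ℝ φ z u) (fderiv ℝ φ z v)
      - fderiv ℝ φ z (christoffel (coordMetric (inducedMetric g f) q) z u v))

/-- The mean curvature vector `H = (1 / n) ∑_i h(e_i, e_i)`, computed in an orthonormal basis `e`
of the tangent space of `N` at `q`. -/
def meanCurvature
    (g : ∀ x : M, TangentSpace 𝓘(ℝ, E) x →L[ℝ] TangentSpace 𝓘(ℝ, E) x →L[ℝ] ℝ) (f : N → M)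
    (q : N) {n : ℕ} (e : Fin n → TangentSpace 𝓘(ℝ, E') q) : TangentSpace 𝓘(ℝ, E) (f q) :=
  (1 / (n : ℝ)) • ∑ i, secondFundamentalForm g f q (e i) (e i)

/-- `f : N → M` is a smooth immersion whose tangent spaces are mapped by `J` to normal vectors.
It makes `N` a Lagrangian submanifold when `dim M = 2 dim N`. -/
structure IsLagrangianImmersion
    (g : ∀ x : M, TangentSpace 𝓘(ℝ, E) x →L[ℝ] TangentSpace 𝓘(ℝ, E) x →L[ℝ] ℝ)
    (J : ∀ x : M, TangentSpace 𝓘(ℝ, E) x →L[ℝ] TangentSpace 𝓘(ℝ, E) x) (f : N → M) : Prop where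
  smooth : ContMDiff 𝓘(ℝ, E') 𝓘(ℝ, E) ∞ f
  immersion : ∀ q, Function.Injective (mfderiv 𝓘(ℝ, E') 𝓘(ℝ, E) f q)
  normal : ∀ (q : N) (v w : TangentSpace 𝓘(ℝ, E') q),
    g (f q) (J (f q) (mfderiv 𝓘(ℝ, E') 𝓘(ℝ, E) f q v)) (mfderiv 𝓘(ℝ, E') 𝓘(ℝ, E) f q w) = 0

/-- The tangential component `α^⊤` of a 1-form `α` at a point of the submanifold. -/
def tangential (f : N → M) (q : N) (α : TangentSpace 𝓘(ℝ, E) (f q) → ℝ)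
    (v : TangentSpace 𝓘(ℝ, E') q) : ℝ :=
  α (mfderiv 𝓘(ℝ, E') 𝓘(ℝ, E) f q v)

/-- The scalar product of 1-forms on a tangent space with orthonormal basis `e`. -/
def formInner {q : N} {n : ℕ} (e : Fin n → TangentSpace 𝓘(ℝ, E') q)
    (α β : TangentSpace 𝓘(ℝ, E') q → ℝ) : ℝ :=
  ∑ i, α (e i) * β (e i)

end Submanifold

end QCH

end

open QCH

set_option maxSynthPendingDepth 3

/-! Existence of `a`, `b`, `c` is pointwise algebra. On a unit vector, `π`, `Φ`, `Ψ` have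
holomorphic sectional curvature `1`, `t`, `t²`, where `t = cos²φ`. Along `r ξ + s v`, with `v` a
unit vector of `D` and `r² + s² = 1`, the holomorphic sectional curvature of `R` is a quartic form
in `r, s` which depends only on `t = r²`. It is therefore a quadratic polynomial in `t`, and its
coefficients are `a`, `b`, `c`. A tensor with the Kähler curvature symmetries and vanishing
holomorphic sectional curvature is zero (`IsKaehlerCurvature.eq_zero`), so `R = aπ + bΦ + cΨ`.

For the inequality, write the Gauss equation in an orthonormal frame whose element `e_o` is `X`.
Since `J` maps tangent vectors to normal ones, for `i ≠ j` it reads `K_ij = a/4 + b/8 (σ_ii + σ_jj)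
+ c ω_ij² + ∑_k (h^k_ii h^k_jj - (h^k_ij)²)`, where `h^k_ij = g(h(e_i, e_j), J e_k)` is totally
symmetric because `∇̄J = 0`. Minimality of `Ric(X)` gives `δ_n = τ - Ric(X)/(n - 1)`. The `a`, `b`,
`c` terms of this difference are computed exactly, using `‖η^⊤‖² + ‖η̃^⊤‖² = 1` for `b` and
Lagrange's identity for `c`.

The terms in `h` are estimated by `sum_trace_form_le`. Squares with three distinct indices are
discarded, and total symmetry turns the others into squares of diagonal entries `h^k_ii`. This
leaves, for each `k`, a quadratic form in `x_i = h^k_ii`, bounded by a multiple of `(∑ x_i)²` in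
`trace_form_le_self` (`k = o`) and `trace_form_le_of_ne` (`k ≠ o`). Summing over `k` gives `n²‖H‖²`.

The differential geometry (curvature symmetries, Gauss equation, symmetry of the cubic form) is
derived in coordinates from covariant derivatives along a map (`covDeriv`) and carried to the
manifold at the centre of each chart. -/

namespace QCH

/-! ### The Levi-Civita connection in coordinates and along maps -/

section CoordinateCalculus

variable {E : Type*} [NormedAddCommGroup E] [NormedSpace ℝ E]

/-- `G` is the matrix of a pseudo-Riemannian metric near the point `z`. -/
structure MetricAt (G : E → E →L[ℝ] E →L[ℝ] ℝ) (z : E) : Prop where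
  contDiffAt : ContDiffAt ℝ 2 G z
  symm : ∀ᶠ y in 𝓝 z, ∀ v w, G y v w = G y w v
  isInvertible : (G z).IsInvertible

/-- The Christoffel symbols with all indices down. -/
noncomputable def lowerChristoffel (G : E → E →L[ℝ] E →L[ℝ] ℝ) (y : E) :
    E →L[ℝ] E →L[ℝ] E →L[ℝ] ℝ :=
  (1 / 2 : ℝ) • (fderiv ℝ G y + (fderiv ℝ G y).flip
    - ((ContinuousLinearMap.flipₗᵢ ℝ E E ℝ).toContinuousLinearEquiv :
        (E →L[ℝ] E →L[ℝ] ℝ) →L[ℝ] E →L[ℝ] E →L[ℝ] ℝ).comp (fderiv ℝ G y).flip)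

/-- The Christoffel symbols as a bilinear map. -/
noncomputable def christoffelMap (G : E → E →L[ℝ] E →L[ℝ] ℝ) (y : E) : E →L[ℝ] E →L[ℝ] E :=
  (ContinuousLinearMap.compL ℝ E (E →L[ℝ] ℝ) E (G y).inverse).comp (lowerChristoffel G y)

theorem christoffelMap_apply (G : E → E →L[ℝ] E →L[ℝ] ℝ) (y v w : E) :
    christoffelMap G y v w = christoffel G y v w := by
  simp [christoffelMap, christoffel, lowerChristoffel]

/-- The derivative of the vector field `W` along the map `φ` in the direction `u`. -/
noncomputable def covDeriv {E' : Type*} [NormedAddCommGroup E'] [NormedSpace ℝ E']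
    (G : E → E →L[ℝ] E →L[ℝ] ℝ) (φ W : E' → E) (u y : E') : E :=
  fderiv ℝ W y u + christoffelMap G (φ y) (fderiv ℝ φ y u) (W y)

/-- Invertible operators form an open set. Identities proved at one point thus hold on a
neighbourhood and may be differentiated. -/
theorem MetricAt.eventually [CompleteSpace E] {G : E → E →L[ℝ] E →L[ℝ] ℝ} {z : E}
    (h : MetricAt G z) : ∀ᶠ y in 𝓝 z, MetricAt G y := by
  have h1 := h.contDiffAt.eventually (by simp)
  have h2 := h.symm.eventually_nhds
  have h3 : ∀ᶠ y in 𝓝 z, (G y).IsInvertible := by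
    obtain ⟨e, he⟩ := h.isInvertible
    have := h.contDiffAt.continuousAt.preimage_mem_nhds (t := {A | A.IsInvertible}) (by
      rw [← he]; exact ContinuousLinearEquiv.nhds e)
    exact this
  filter_upwards [h1, h2, h3] with y a b c using ⟨a, b, c⟩

namespace MetricAt

variable {G : E → E →L[ℝ] E →L[ℝ] ℝ} {z : E}

theorem fderiv_symm (h : MetricAt G z) (u v w : E) :
    fderiv ℝ G z u v w = fderiv ℝ G z u w v := by
  have hd : DifferentiableAt ℝ G z := h.contDiffAt.differentiableAt (by simp)
  have key : ∀ a b : E, fderiv ℝ (fun y ↦ G y a b) z u = fderiv ℝ G z u a b := by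
    intro a b
    have := ((hd.hasFDerivAt.clm_apply (hasFDerivAt_const a z)).clm_apply
      (hasFDerivAt_const b z)).fderiv
    simp [this]
  rw [← key, ← key]
  congr 1
  apply Filter.EventuallyEq.fderiv_eq
  filter_upwards [h.symm] with y hy using hy v w

theorem apply_symm (h : MetricAt G z) (v w : E) : G z v w = G z w v :=
  h.symm.self_of_nhds v w

theorem apply_christoffel (h : MetricAt G z) (v w x : E) :
    G z (christoffelMap G z v w) x
      = 1 / 2 * (fderiv ℝ G z v w x + fderiv ℝ G z w v x - fderiv ℝ G z x v w) := by
  rw [christoffelMap_apply, christoffel, h.isInvertible.self_apply_inverse]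
  simp

theorem christoffel_symm (h : MetricAt G z) (v w : E) :
    christoffelMap G z v w = christoffelMap G z w v := by
  apply h.isInvertible.injective
  ext x
  rw [h.apply_christoffel, h.apply_christoffel, h.fderiv_symm x v w]
  ring

/-- Compatibility `∇G = 0` of the connection with the metric. -/
theorem fderiv_eq (h : MetricAt G z) (u v w : E) :
    fderiv ℝ G z u v w
      = G z (christoffelMap G z u v) w + G z v (christoffelMap G z u w) := by
  rw [h.apply_symm v, h.apply_christoffel, h.apply_christoffel, h.fderiv_symm v u w,
    h.fderiv_symm w u v, h.fderiv_symm u w v]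
  ring

theorem contDiffAt_christoffelMap [CompleteSpace E] (h : MetricAt G z) :
    ContDiffAt ℝ 1 (christoffelMap G) z := by
  have h1 : ContDiffAt ℝ 1 (fderiv ℝ G) z := h.contDiffAt.fderiv_right (by norm_num)
  have h2 : ContDiffAt ℝ 1 (fun y ↦ (G y).inverse) z :=
    (h.isInvertible.contDiffAt_map_inverse (n := 1)).comp z (h.contDiffAt.of_le (by norm_num))
  have h3 : ContDiffAt ℝ 1 (fun y ↦ (fderiv ℝ G y).flip) z :=
    (ContinuousLinearMap.flipₗᵢ ℝ E E (E →L[ℝ] ℝ)).contDiff.contDiffAt.comp z h1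
  have h4 : ContDiffAt ℝ 1 (lowerChristoffel G) z :=
    ((h1.add h3).sub (contDiffAt_const.clm_comp h3)).const_smul _
  exact ((ContinuousLinearMap.compL ℝ E (E →L[ℝ] ℝ) E).contDiff.contDiffAt.comp z h2).clm_comp h4

theorem hasFDerivAt_christoffelMap [CompleteSpace E] (h : MetricAt G z) :
    HasFDerivAt (christoffelMap G) (fderiv ℝ (christoffelMap G) z) z :=
  (h.contDiffAt_christoffelMap.differentiableAt (by simp)).hasFDerivAt

theorem coordCurvature_eq [CompleteSpace E] (h : MetricAt G z) (u v w : E) :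
    coordCurvature G z u v w = fderiv ℝ (christoffelMap G) z u v w
      - fderiv ℝ (christoffelMap G) z v u w
      + christoffelMap G z u (christoffelMap G z v w)
      - christoffelMap G z v (christoffelMap G z u w) := by
  have key : ∀ a b c : E, fderiv ℝ (fun y ↦ christoffel G y a b) z c
      = fderiv ℝ (christoffelMap G) z c a b := by
    intro a b c
    have := ((h.hasFDerivAt_christoffelMap.clm_apply (hasFDerivAt_const a z)).clm_apply
      (hasFDerivAt_const b z)).fderiv
    simp only [christoffelMap_apply] at this
    simp [this]
  rw [coordCurvature, key, key]
  simp only [christoffelMap_apply]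

/-- Vanishing torsion holds near `z`, so the derivative of the Christoffel symbols is symmetric in
the lower slots too, and the cyclic sum cancels in pairs. -/
theorem coordCurvature_bianchi [CompleteSpace E] (h : MetricAt G z) (u v w : E) :
    coordCurvature G z u v w + coordCurvature G z v w u + coordCurvature G z w u v = 0 := by
  have key : ∀ a b c : E, fderiv ℝ (christoffelMap G) z c a b
      = fderiv ℝ (christoffelMap G) z c b a := by
    intro a b c
    have e : ∀ a b : E, fderiv ℝ (fun y ↦ christoffelMap G y a b) z c
        = fderiv ℝ (christoffelMap G) z c a b := by
      intro a b
      have := ((h.hasFDerivAt_christoffelMap.clm_apply (hasFDerivAt_const a z)).clm_apply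
        (hasFDerivAt_const b z)).fderiv
      simp [this]
    rw [← e, ← e]
    congr 1
    apply Filter.EventuallyEq.fderiv_eq
    filter_upwards [h.eventually] with y hy using hy.christoffel_symm a b
  rw [h.coordCurvature_eq, h.coordCurvature_eq, h.coordCurvature_eq, key w v, key v u w,
    key w u v, h.christoffel_symm w v, h.christoffel_symm u w, h.christoffel_symm v u]
  abel

section Along

variable {E' : Type*} [NormedAddCommGroup E'] [NormedSpace ℝ E'] {φ : E' → E} {x : E'}

theorem fderiv_apply_eq {W V : E' → E} (h : MetricAt G (φ x))
    (hφ : DifferentiableAt ℝ φ x) (hW : DifferentiableAt ℝ W x) (hV : DifferentiableAt ℝ V x)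
    (u : E') :
    fderiv ℝ (fun y ↦ G (φ y) (W y) (V y)) x u
      = G (φ x) (covDeriv G φ W u x) (V x) + G (φ x) (W x) (covDeriv G φ V u x) := by
  have hd : DifferentiableAt ℝ G (φ x) := h.contDiffAt.differentiableAt (by simp)
  have hG : HasFDerivAt (fun y ↦ G (φ y)) ((fderiv ℝ G (φ x)).comp (fderiv ℝ φ x)) x :=
    hd.hasFDerivAt.comp x hφ.hasFDerivAt
  rw [((hG.clm_apply hW.hasFDerivAt).clm_apply hV.hasFDerivAt).fderiv]
  simp [covDeriv, h.fderiv_eq]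
  ring

theorem fderiv_covDeriv [CompleteSpace E] {W : E' → E} (h : MetricAt G (φ x))
    (hφ : ContDiffAt ℝ 2 φ x) (hW : ContDiffAt ℝ 2 W x) (u v : E') :
    fderiv ℝ (covDeriv G φ W v) x u = fderiv ℝ (fderiv ℝ W) x u v
      + fderiv ℝ (christoffelMap G) (φ x) (fderiv ℝ φ x u) (fderiv ℝ φ x v) (W x)
      + christoffelMap G (φ x) (fderiv ℝ (fderiv ℝ φ) x u v) (W x)
      + christoffelMap G (φ x) (fderiv ℝ φ x v) (fderiv ℝ W x u) := by
  have dφ := (hφ.differentiableAt (by simp)).hasFDerivAt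
  have dW := (hW.differentiableAt (by simp)).hasFDerivAt
  have ddφ := ((hφ.fderiv_right (m := 1) (by norm_num)).differentiableAt (by simp)).hasFDerivAt
  have ddW := ((hW.fderiv_right (m := 1) (by norm_num)).differentiableAt (by simp)).hasFDerivAt
  have hc := hasFDerivAt_const (𝕜 := ℝ) v x
  have := ((ddW.clm_apply hc).add
    (((h.hasFDerivAt_christoffelMap.comp x dφ).clm_apply (ddφ.clm_apply hc)).clm_apply dW)).fderiv
  have e : covDeriv G φ W v = (fun y ↦ fderiv ℝ W y v) +
      fun y ↦ ((christoffelMap G ∘ φ) y) (fderiv ℝ φ y v) (W y) := rfl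
  rw [e, this]
  simp
  abel

/-- Second derivatives of `φ` and `W` are symmetric and drop out of the commutator. With `φ = id`
this gives the intrinsic curvature. With an immersion `φ` it gives the ambient curvature on tangent
vectors, which is what the Gauss equation needs. -/
theorem covDeriv_comm [CompleteSpace E] {W : E' → E} (h : MetricAt G (φ x))
    (hφ : ContDiffAt ℝ 2 φ x) (hW : ContDiffAt ℝ 2 W x) (u v : E') :
    covDeriv G φ (covDeriv G φ W v) u x - covDeriv G φ (covDeriv G φ W u) v x
      = coordCurvature G (φ x) (fderiv ℝ φ x u) (fderiv ℝ φ x v) (W x) := by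
  have s1 : fderiv ℝ (fderiv ℝ φ) x u v = fderiv ℝ (fderiv ℝ φ) x v u :=
    (hφ.isSymmSndFDerivAt (by simp)).eq u v
  have s2 : fderiv ℝ (fderiv ℝ W) x u v = fderiv ℝ (fderiv ℝ W) x v u :=
    (hW.isSymmSndFDerivAt (by simp)).eq u v
  rw [h.coordCurvature_eq, covDeriv.eq_1 _ _ (covDeriv G φ W v),
    covDeriv.eq_1 _ _ (covDeriv G φ W u), h.fderiv_covDeriv hφ hW,
    h.fderiv_covDeriv hφ hW, s1, s2]
  simp only [covDeriv, map_add]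
  abel

end Along

end MetricAt

end CoordinateCalculus

/-! ### Curvature symmetries and parallel endomorphisms -/

section CoordinateCalculus

variable {E : Type*} [NormedAddCommGroup E] [NormedSpace ℝ E] [CompleteSpace E]
  {E' : Type*} [NormedAddCommGroup E'] [NormedSpace ℝ E']

theorem fderiv_fderiv_apply {F : Type*} [NormedAddCommGroup F] [NormedSpace ℝ F] {s : E' → F}
    {x : E'} (hs : ContDiffAt ℝ 2 s x) (u v : E') :
    fderiv ℝ (fun y ↦ fderiv ℝ s y v) x u = fderiv ℝ (fderiv ℝ s) x u v := by
  have h := ((hs.fderiv_right (m := 1) (by norm_num)).differentiableAt (by simp)).hasFDerivAt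
  rw [(h.clm_apply (hasFDerivAt_const v x)).fderiv]
  simp

theorem fderiv_fderiv_apply_comm {F : Type*} [NormedAddCommGroup F] [NormedSpace ℝ F] {s : E' → F}
    {x : E'} (hs : ContDiffAt ℝ 2 s x) (u v : E') :
    fderiv ℝ (fun y ↦ fderiv ℝ s y v) x u = fderiv ℝ (fun y ↦ fderiv ℝ s y u) x v := by
  rw [fderiv_fderiv_apply hs, fderiv_fderiv_apply hs]
  exact (hs.isSymmSndFDerivAt (by simp)).eq u v

omit [CompleteSpace E] in
theorem covDeriv_congr {G : E → E →L[ℝ] E →L[ℝ] ℝ} {φ W V : E' → E} {x : E'}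
    (h : W =ᶠ[𝓝 x] V) (u : E') : covDeriv G φ W u x = covDeriv G φ V u x := by
  rw [covDeriv, covDeriv, h.fderiv_eq, h.self_of_nhds]

omit [CompleteSpace E] in
theorem covDeriv_id_const (G : E → E →L[ℝ] E →L[ℝ] ℝ) (w u y : E) :
    covDeriv G id (fun _ ↦ w) u y = christoffelMap G y u w := by
  simp [covDeriv]

namespace MetricAt

variable {G : E → E →L[ℝ] E →L[ℝ] ℝ} {z : E}

theorem differentiableAt_covDeriv {φ W : E' → E} {x : E'} (h : MetricAt G (φ x))
    (hφ : ContDiffAt ℝ 2 φ x) (hW : ContDiffAt ℝ 2 W x) (v : E') :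
    DifferentiableAt ℝ (covDeriv G φ W v) x := by
  have dφ := hφ.differentiableAt (by simp)
  have dW := hW.differentiableAt (by simp)
  have ddφ := (hφ.fderiv_right (m := 1) (by norm_num)).differentiableAt (by simp)
  have ddW := (hW.fderiv_right (m := 1) (by norm_num)).differentiableAt (by simp)
  have hG := h.hasFDerivAt_christoffelMap.differentiableAt.comp x dφ
  have hc : DifferentiableAt ℝ (fun _ : E' ↦ v) x := differentiableAt_const v
  exact (ddW.clm_apply hc).add ((hG.clm_apply (ddφ.clm_apply hc)).clm_apply dW)

/-- Second derivatives of `s = G(w, w)`, with `w` constant, commute. By metric compatibility their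
difference is `2 G(R(u, v) w, w)`, since the products of first covariant derivatives are symmetric
in `u`, `v`. -/
theorem apply_coordCurvature_self (h : MetricAt G z) (u v w : E) :
    G z (coordCurvature G z u v w) w = 0 := by
  set s : E → ℝ := fun y ↦ G y w w
  have hs : ContDiffAt ℝ 2 s z :=
    (h.contDiffAt.clm_apply contDiffAt_const).clm_apply contDiffAt_const
  have hc : ContDiffAt ℝ 2 (fun _ : E ↦ w) z := contDiffAt_const
  have hid : ContDiffAt ℝ 2 (id : E → E) z := contDiffAt_id
  have hi : MetricAt G (id z) := h
  have h1 : ∀ a : E, (fun y ↦ fderiv ℝ s y a) =ᶠ[𝓝 z]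
      fun y ↦ 2 * G (id y) (covDeriv G id (fun _ ↦ w) a y) w := by
    intro a
    filter_upwards [h.eventually] with y hy
    have hy' : MetricAt G (id y) := hy
    have e := hy'.fderiv_apply_eq (φ := id) (W := fun _ ↦ w) (V := fun _ ↦ w) (x := y)
      differentiableAt_id (differentiableAt_const w) (differentiableAt_const w) a
    have e2 : fderiv ℝ s y a = _ := e
    rw [e2, hy'.apply_symm w]
    ring
  have h2 : ∀ a b : E, fderiv ℝ (fun y ↦ fderiv ℝ s y a) z b
      = 2 * (G z (covDeriv G id (covDeriv G id (fun _ ↦ w) a) b z) w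
        + G z (covDeriv G id (fun _ ↦ w) a z) (covDeriv G id (fun _ ↦ w) b z)) := by
    intro a b
    have hd := hi.differentiableAt_covDeriv hid hc a
    have e := hi.fderiv_apply_eq (φ := id) (V := fun _ ↦ w) differentiableAt_id hd
      (differentiableAt_const w) b
    have hdiff : DifferentiableAt ℝ
        (fun y ↦ G (id y) (covDeriv G id (fun _ ↦ w) a y) w) z :=
      ((h.contDiffAt.differentiableAt (by simp)).clm_apply hd).clm_apply (differentiableAt_const w)
    rw [(h1 a).fderiv_eq, fderiv_const_mul hdiff, smul_apply, e]
    rfl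
  have h3 := fderiv_fderiv_apply_comm hs u v
  have h4 := hi.covDeriv_comm hid hc u v
  simp only [id_eq, fderiv_id, ContinuousLinearMap.id_apply] at h4
  rw [h2, h2, h.apply_symm (covDeriv G id (fun _ ↦ w) v z)] at h3
  rw [← h4, map_sub, sub_apply]
  linarith

theorem coordCurvature_add_right (h : MetricAt G z) (u v w w' : E) :
    coordCurvature G z u v (w + w') = coordCurvature G z u v w + coordCurvature G z u v w' := by
  simp only [h.coordCurvature_eq, map_add]
  abel

theorem coordCurvature_add_left (h : MetricAt G z) (u u' v w : E) :
    coordCurvature G z (u + u') v w = coordCurvature G z u v w + coordCurvature G z u' v w := by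
  simp only [h.coordCurvature_eq, map_add, add_apply]
  abel

theorem coordCurvature_smul_left (h : MetricAt G z) (c : ℝ) (u v w : E) :
    coordCurvature G z (c • u) v w = c • coordCurvature G z u v w := by
  simp only [h.coordCurvature_eq, map_smul, smul_apply]
  module

omit [CompleteSpace E] in
theorem coordCurvature_swap (u v w : E) :
    coordCurvature G z u v w = -coordCurvature G z v u w := by
  simp only [coordCurvature]
  abel

theorem apply_coordCurvature_swap (h : MetricAt G z) (u v w x : E) :
    G z (coordCurvature G z u v w) x = -G z (coordCurvature G z u v x) w := by
  have := h.apply_coordCurvature_self u v (w + x)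
  simp only [h.coordCurvature_add_right, map_add, add_apply,
    h.apply_coordCurvature_self] at this
  linarith

end MetricAt

/-- `J` is a parallel field of endomorphisms near the point `z`. -/
structure ParallelAt (G : E → E →L[ℝ] E →L[ℝ] ℝ) (J : E → E →L[ℝ] E) (z : E) : Prop where
  contDiffAt : ContDiffAt ℝ 2 J z
  parallel : ∀ᶠ y in 𝓝 z, ∀ v w, fderiv ℝ J y v w + christoffelMap G y v (J y w)
    - J y (christoffelMap G y v w) = 0

namespace ParallelAt

variable {G : E → E →L[ℝ] E →L[ℝ] ℝ} {J : E → E →L[ℝ] E} {z : E}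

omit [CompleteSpace E] in
theorem eventually (h : ParallelAt G J z) : ∀ᶠ y in 𝓝 z, ParallelAt G J y := by
  filter_upwards [h.contDiffAt.eventually (by simp), h.parallel.eventually_nhds] with y a b
    using ⟨a, b⟩

omit [CompleteSpace E] in
theorem covDeriv_apply {φ W : E' → E} {x : E'} (h : ParallelAt G J (φ x))
    (hφ : DifferentiableAt ℝ φ x) (hW : DifferentiableAt ℝ W x) (u : E') :
    covDeriv G φ (fun y ↦ J (φ y) (W y)) u x = J (φ x) (covDeriv G φ W u x) := by
  have hd : DifferentiableAt ℝ J (φ x) := h.contDiffAt.differentiableAt (by simp)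
  have hJ : HasFDerivAt (fun y ↦ J (φ y)) ((fderiv ℝ J (φ x)).comp (fderiv ℝ φ x)) x :=
    hd.hasFDerivAt.comp x hφ.hasFDerivAt
  have := h.parallel.self_of_nhds (fderiv ℝ φ x u) (W x)
  rw [covDeriv, (hJ.clm_apply hW.hasFDerivAt).fderiv, covDeriv, map_add]
  simp only [add_apply, ContinuousLinearMap.comp_apply, ContinuousLinearMap.flip_apply]
  rw [sub_eq_zero] at this
  rw [← this]
  abel

/-- `J` commutes with one covariant derivative on a whole neighbourhood, hence with two, hence with
their commutator. -/
theorem coordCurvature_apply (h : ParallelAt G J z) (hG : MetricAt G z) (u v w : E) :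
    coordCurvature G z u v (J z w) = J z (coordCurvature G z u v w) := by
  have hid : ContDiffAt ℝ 2 (id : E → E) z := contDiffAt_id
  have hi : MetricAt G (id z) := hG
  have hj : ParallelAt G J (id z) := h
  have hc : ContDiffAt ℝ 2 (fun _ : E ↦ w) z := contDiffAt_const
  have hJ : ContDiffAt ℝ 2 (fun y ↦ J (id y) w) z := h.contDiffAt.clm_apply contDiffAt_const
  have key : ∀ a b : E, covDeriv G id (covDeriv G id (fun y ↦ J (id y) w) a) b z
      = J z (covDeriv G id (covDeriv G id (fun _ ↦ w) a) b z) := by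
    intro a b
    have e : covDeriv G id (fun y ↦ J (id y) w) a =ᶠ[𝓝 z]
        fun y ↦ J (id y) (covDeriv G id (fun _ ↦ w) a y) := by
      filter_upwards [h.eventually] with y hy
      exact ParallelAt.covDeriv_apply (φ := id) hy differentiableAt_id (differentiableAt_const w) a
    rw [covDeriv_congr e, hj.covDeriv_apply differentiableAt_id
      (hi.differentiableAt_covDeriv hid hc a)]
    rfl
  have h1 := hi.covDeriv_comm hid hJ u v
  have h2 := hi.covDeriv_comm hid hc u v
  simp only [fderiv_id, ContinuousLinearMap.id_apply] at h1 h2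
  rw [key, key, ← map_sub, h2] at h1
  exact h1.symm

end ParallelAt

/-! ### Isometric maps: Gauss equation and the Lagrangian cubic form -/

/-- Near `x`, `G'` is the metric induced from `G` by the map `φ`. -/
structure IsometryAt (G' : E' → E' →L[ℝ] E' →L[ℝ] ℝ) (G : E → E →L[ℝ] E →L[ℝ] ℝ) (φ : E' → E)
    (x : E') : Prop where
  metric : MetricAt G (φ x)
  metric' : MetricAt G' x
  contDiffAt : ContDiffAt ℝ 3 φ x
  apply_eq : ∀ᶠ y in 𝓝 x, ∀ v w, G' y v w = G (φ y) (fderiv ℝ φ y v) (fderiv ℝ φ y w)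

/-- The second fundamental form of `φ` in coordinates. -/
noncomputable def coordSff (G' : E' → E' →L[ℝ] E' →L[ℝ] ℝ) (G : E → E →L[ℝ] E →L[ℝ] ℝ)
    (φ : E' → E) (x v w : E') : E :=
  fderiv ℝ (fderiv ℝ φ) x v w + christoffelMap G (φ x) (fderiv ℝ φ x v) (fderiv ℝ φ x w)
    - fderiv ℝ φ x (christoffelMap G' x v w)

namespace IsometryAt

variable [CompleteSpace E'] {G' : E' → E' →L[ℝ] E' →L[ℝ] ℝ} {G : E → E →L[ℝ] E →L[ℝ] ℝ}
  {φ : E' → E} {x : E'}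

theorem eventually (h : IsometryAt G' G φ x) : ∀ᶠ y in 𝓝 x, IsometryAt G' G φ y := by
  filter_upwards [h.contDiffAt.continuousAt.eventually h.metric.eventually, h.metric'.eventually,
    h.contDiffAt.eventually (by simp), h.apply_eq.eventually_nhds] with y a b c d
    using ⟨a, b, c, d⟩

omit [CompleteSpace E] [CompleteSpace E'] in
theorem contDiffAt_two (h : IsometryAt G' G φ x) : ContDiffAt ℝ 2 φ x :=
  h.contDiffAt.of_le (by norm_num)

omit [CompleteSpace E] [CompleteSpace E'] in
theorem contDiffAt_fderiv_apply (h : IsometryAt G' G φ x) (w : E') :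
    ContDiffAt ℝ 2 (fun y ↦ fderiv ℝ φ y w) x :=
  (h.contDiffAt.fderiv_right (m := 2) (by norm_num)).clm_apply contDiffAt_const

omit [CompleteSpace E] [CompleteSpace E'] in
theorem covDeriv_eq (h : IsometryAt G' G φ x) (v w : E') :
    covDeriv G φ (fun y ↦ fderiv ℝ φ y w) v x
      = fderiv ℝ φ x (christoffelMap G' x v w) + coordSff G' G φ x v w := by
  rw [covDeriv, coordSff, fderiv_fderiv_apply h.contDiffAt_two]
  abel

omit [CompleteSpace E] [CompleteSpace E'] in
theorem coordSff_symm (h : IsometryAt G' G φ x) (v w : E') :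
    coordSff G' G φ x v w = coordSff G' G φ x w v := by
  rw [coordSff, coordSff, h.metric.christoffel_symm, h.metric'.christoffel_symm,
    (h.contDiffAt_two.isSymmSndFDerivAt (by simp)).eq v w]

omit [CompleteSpace E] [CompleteSpace E'] in
theorem covDeriv_symm (h : IsometryAt G' G φ x) (v w : E') :
    covDeriv G φ (fun y ↦ fderiv ℝ φ y w) v x = covDeriv G φ (fun y ↦ fderiv ℝ φ y v) w x := by
  rw [h.covDeriv_eq, h.covDeriv_eq, h.coordSff_symm, h.metric'.christoffel_symm]

omit [CompleteSpace E] [CompleteSpace E'] in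
-- Koszul's argument. Differentiating the isometry identity expresses `∂G'` by products with `∇̄_u
-- dφ(v)`, which is symmetric in `u`, `v`; the Koszul combination of three such derivatives isolates
-- one product. Hence the tangential part of `∇̄` is the induced connection.
theorem apply_covDeriv (h : IsometryAt G' G φ x) (v w z : E') :
    G (φ x) (covDeriv G φ (fun y ↦ fderiv ℝ φ y w) v x) (fderiv ℝ φ x z)
      = G' x (christoffelMap G' x v w) z := by
  have key : ∀ u v w : E', fderiv ℝ G' x u v w
      = G (φ x) (covDeriv G φ (fun y ↦ fderiv ℝ φ y v) u x) (fderiv ℝ φ x w)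
        + G (φ x) (covDeriv G φ (fun y ↦ fderiv ℝ φ y w) u x) (fderiv ℝ φ x v) := by
    intro u v w
    have hd : DifferentiableAt ℝ G' x := h.metric'.contDiffAt.differentiableAt (by simp)
    have e1 : fderiv ℝ (fun y ↦ G' y v w) x u = fderiv ℝ G' x u v w := by
      rw [((hd.hasFDerivAt.clm_apply (hasFDerivAt_const v x)).clm_apply
        (hasFDerivAt_const w x)).fderiv]
      simp
    have e2 : (fun y ↦ G' y v w) =ᶠ[𝓝 x]
        fun y ↦ G (φ y) (fderiv ℝ φ y v) (fderiv ℝ φ y w) := by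
      filter_upwards [h.apply_eq] with y hy using hy v w
    rw [← e1, e2.fderiv_eq, h.metric.fderiv_apply_eq (h.contDiffAt.differentiableAt (by simp))
      ((h.contDiffAt_fderiv_apply v).differentiableAt (by simp))
      ((h.contDiffAt_fderiv_apply w).differentiableAt (by simp)),
      h.metric.apply_symm (fderiv ℝ φ x v)]
  rw [h.metric'.apply_christoffel, key, key, key, h.covDeriv_symm z w, h.covDeriv_symm z v,
    h.covDeriv_symm w v]
  ring

omit [CompleteSpace E] [CompleteSpace E'] in
theorem apply_coordSff (h : IsometryAt G' G φ x) (v w z : E') :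
    G (φ x) (coordSff G' G φ x v w) (fderiv ℝ φ x z) = 0 := by
  have h1 := h.apply_covDeriv v w z
  rw [h.covDeriv_eq, map_add, add_apply, ← h.apply_eq.self_of_nhds] at h1
  linarith

/-- `apply_covDeriv` is an identity near `x`, so it can be differentiated once more. The product
rules on the two sides differ by the product of the normal parts, and antisymmetrising in `u`, `v`
yields the equation. -/
theorem gauss (h : IsometryAt G' G φ x) (u v w z : E') :
    G' x (coordCurvature G' x u v w) z
      = G (φ x) (coordCurvature G (φ x) (fderiv ℝ φ x u) (fderiv ℝ φ x v) (fderiv ℝ φ x w))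
          (fderiv ℝ φ x z)
        + G (φ x) (coordSff G' G φ x v w) (coordSff G' G φ x u z)
        - G (φ x) (coordSff G' G φ x u w) (coordSff G' G φ x v z) := by
  have hi : MetricAt G' (id x) := h.metric'
  have hid : ContDiffAt ℝ 2 (id : E' → E') x := contDiffAt_id
  have hc : ContDiffAt ℝ 2 (fun _ : E' ↦ w) x := contDiffAt_const
  have key : ∀ a b : E',
      G (φ x) (covDeriv G φ (covDeriv G φ (fun y ↦ fderiv ℝ φ y w) b) a x) (fderiv ℝ φ x z)
        = G' x (covDeriv G' id (covDeriv G' id (fun _ ↦ w) b) a x) z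
          - G (φ x) (coordSff G' G φ x b w) (coordSff G' G φ x a z) := by
    intro a b
    have e : (fun y ↦ G (φ y) (covDeriv G φ (fun y ↦ fderiv ℝ φ y w) b y) (fderiv ℝ φ y z))
        =ᶠ[𝓝 x] fun y ↦ G' (id y) (covDeriv G' id (fun _ ↦ w) b y) z := by
      filter_upwards [h.eventually] with y hy
      rw [hy.apply_covDeriv, covDeriv_id_const]
      rfl
    have e1 := congrArg (fun A : E' →L[ℝ] ℝ ↦ A a) e.fderiv_eq
    rw [h.metric.fderiv_apply_eq (h.contDiffAt.differentiableAt (by simp))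
      (h.metric.differentiableAt_covDeriv h.contDiffAt_two (h.contDiffAt_fderiv_apply w) b)
      ((h.contDiffAt_fderiv_apply z).differentiableAt (by simp)),
      hi.fderiv_apply_eq (V := fun _ ↦ z) differentiableAt_id
        (hi.differentiableAt_covDeriv hid hc b) (differentiableAt_const z),
      covDeriv_id_const, covDeriv_id_const, h.covDeriv_eq, h.covDeriv_eq] at e1
    simp only [id_eq, map_add, add_apply, h.apply_coordSff, ← h.apply_eq.self_of_nhds,
      h.metric.apply_symm (fderiv ℝ φ x _) (coordSff G' G φ x a z)] at e1
    linarith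
  have h1 := h.metric.covDeriv_comm h.contDiffAt_two (h.contDiffAt_fderiv_apply w) u v
  have h2 := hi.covDeriv_comm hid hc u v
  simp only [id_eq, fderiv_id, ContinuousLinearMap.id_apply] at h2
  rw [← h1, ← h2, map_sub, map_sub, sub_apply, sub_apply, key, key]
  ring

omit [CompleteSpace E] [CompleteSpace E'] in
-- Differentiate `G(J dφ(v), dφ(w)) = 0` along `u`. As `J` is parallel and tangential parts pair to
-- zero with `J` of tangent vectors, only the two normal terms survive.
theorem lagrangian_coordSff_symm {J : E → E →L[ℝ] E} (h : IsometryAt G' G φ x)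
    (hJ : ParallelAt G J (φ x))
    (hskew : ∀ v w, G (φ x) (J (φ x) v) w = -G (φ x) v (J (φ x) w))
    (hn : ∀ᶠ y in 𝓝 x, ∀ v w, G (φ y) (J (φ y) (fderiv ℝ φ y v)) (fderiv ℝ φ y w) = 0)
    (u v w : E') :
    G (φ x) (coordSff G' G φ x u v) (J (φ x) (fderiv ℝ φ x w))
      = G (φ x) (coordSff G' G φ x u w) (J (φ x) (fderiv ℝ φ x v)) := by
  have hφ := h.contDiffAt.differentiableAt (by simp)
  have hv := (h.contDiffAt_fderiv_apply v).differentiableAt (by simp)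
  have hw := (h.contDiffAt_fderiv_apply w).differentiableAt (by simp)
  have e : (fun y ↦ G (φ y) (J (φ y) (fderiv ℝ φ y v)) (fderiv ℝ φ y w)) =ᶠ[𝓝 x]
      fun _ ↦ (0 : ℝ) := by
    filter_upwards [hn] with y hy using hy v w
  have hJv : DifferentiableAt ℝ (fun y ↦ J (φ y) (fderiv ℝ φ y v)) x :=
    ((hJ.contDiffAt.differentiableAt (by simp)).comp x hφ).clm_apply hv
  have e1 := congrArg (fun A : E' →L[ℝ] ℝ ↦ A u) e.fderiv_eq
  have hn0 := hn.self_of_nhds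
  simp only [fderiv_fun_const, Pi.zero_apply, zero_apply] at e1
  rw [h.metric.fderiv_apply_eq hφ hJv hw, hJ.covDeriv_apply hφ hv, hskew, h.covDeriv_eq,
    h.covDeriv_eq, map_add, map_add, add_apply, h.metric.apply_symm (fderiv ℝ φ x _), hn0, hn0,
    h.metric.apply_symm (J (φ x) _)] at e1
  linarith

end IsometryAt

end CoordinateCalculus

/-! ### Tensor components in a chart and their smoothness -/

section Charts

variable {E : Type*} [NormedAddCommGroup E] [NormedSpace ℝ E]
  {M : Type*} [TopologicalSpace M] [ChartedSpace E M] [IsManifold 𝓘(ℝ, E) ∞ M]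

local notation "Ch" => extChartAt 𝓘(ℝ, E)

theorem isManifold_one : IsManifold 𝓘(ℝ, E) 1 M := IsManifold.of_le (n := ∞) (by simp)

theorem dChart_self (p : M) : dChart p p = ContinuousLinearMap.id ℝ (TangentSpace 𝓘(ℝ, E) p) := by
  have := isManifold_one (E := E) (M := M)
  exact mfderiv_extChartAt_self

theorem dChart_eq_continuousLinearMapAt (p : M) {x : M} (hx : x ∈ (Ch p).source) :
    dChart p x = (trivializationAt E (TangentSpace 𝓘(ℝ, E)) p).continuousLinearMapAt ℝ x := by
  have := isManifold_one (E := E) (M := M)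
  rw [TangentBundle.continuousLinearMapAt_trivializationAt (by simpa using hx)]
  rfl

theorem dChartSymm_eq_symmL (p : M) {x : M} (hx : x ∈ (Ch p).source) :
    mfderiv 𝓘(ℝ, E) 𝓘(ℝ, E) (Ch p).symm (Ch p x)
      = (trivializationAt E (TangentSpace 𝓘(ℝ, E)) p).symmL ℝ x := by
  have := isManifold_one (E := E) (M := M)
  rw [TangentBundle.symmL_trivializationAt (by simpa using hx), modelWithCornersSelf_coe,
    Set.range_id, mfderivWithin_univ]

omit [IsManifold 𝓘(ℝ, E) ∞ M] in
theorem mfderiv_eq_fderiv_writtenInExtChartAt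
    {E' : Type*} [NormedAddCommGroup E'] [NormedSpace ℝ E']
    {N : Type*} [TopologicalSpace N] [ChartedSpace E' N] {f : N → M} {q : N}
    (hf : MDifferentiableAt 𝓘(ℝ, E') 𝓘(ℝ, E) f q) :
    mfderiv 𝓘(ℝ, E') 𝓘(ℝ, E) f q
      = fderiv ℝ (writtenInExtChartAt 𝓘(ℝ, E') 𝓘(ℝ, E) q f) (extChartAt 𝓘(ℝ, E') q q) := by
  rw [hf.mfderiv, modelWithCornersSelf_coe, Set.range_id, fderivWithin_univ]

theorem dChartSymm_comp_dChart (p : M) {y : E} (hy : y ∈ (Ch p).target) :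
    (dChartSymm p y).comp (dChart p ((Ch p).symm y))
      = ContinuousLinearMap.id ℝ (TangentSpace 𝓘(ℝ, E) ((Ch p).symm y)) := by
  have := isManifold_one (E := E) (M := M)
  have := mfderivWithin_extChartAt_symm_comp_mfderiv_extChartAt (I := 𝓘(ℝ, E)) hy
  simp only [modelWithCornersSelf_coe, Set.range_id, mfderivWithin_univ] at this
  exact this

theorem dChartSymm_self (p : M) :
    (dChartSymm p (Ch p p) : E → E) = id := by
  have := isManifold_one (E := E) (M := M)
  have := mfderivWithin_range_extChartAt_symm (I := 𝓘(ℝ, E)) (x := p)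
  rw [modelWithCornersSelf_coe, Set.range_id, mfderivWithin_univ] at this
  exact congrArg (fun A : E →L[ℝ] E ↦ (A : E → E)) this

omit [IsManifold 𝓘(ℝ, E) ∞ M] in
theorem coordMetric_apply
    (g : ∀ x : M, TangentSpace 𝓘(ℝ, E) x →L[ℝ] TangentSpace 𝓘(ℝ, E) x →L[ℝ] ℝ) (p : M)
    (y v w : E) : coordMetric g p y v w
      = g ((Ch p).symm y) (dChartSymm p y v) (dChartSymm p y w) := rfl

theorem apply_dChartSymm_self {β : Type*}
    (P : ∀ x : M, TangentSpace 𝓘(ℝ, E) x → TangentSpace 𝓘(ℝ, E) x → β) (p : M) (v w : E) :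
    P ((Ch p).symm (Ch p p)) (dChartSymm p (Ch p p) v) (dChartSymm p (Ch p p) w) = P p v w := by
  have hv : (dChartSymm p (Ch p p) v : E) = v := congrFun (dChartSymm_self p) v
  have hw : (dChartSymm p (Ch p p) w : E) = w := congrFun (dChartSymm_self p) w
  -- All tangent spaces unfold to the model `E`. With arguments typed in `E`, base point and vectors
  -- can be rewritten independently.
  let P' : M → E → E → β := fun x a b ↦ P x a b
  change P' _ (dChartSymm p (Ch p p) v : E) (dChartSymm p (Ch p p) w : E) = P' p v w
  rw [hv, hw, extChartAt_to_inv]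

theorem coordMetric_self
    (g : ∀ x : M, TangentSpace 𝓘(ℝ, E) x →L[ℝ] TangentSpace 𝓘(ℝ, E) x →L[ℝ] ℝ) (p : M)
    (v w : E) : coordMetric g p (Ch p p) v w = g p v w :=
  apply_dChartSymm_self (fun x v w ↦ g x v w) p v w

theorem coordMetric_coordEndo
    (g : ∀ x : M, TangentSpace 𝓘(ℝ, E) x →L[ℝ] TangentSpace 𝓘(ℝ, E) x →L[ℝ] ℝ)
    (J : ∀ x : M, TangentSpace 𝓘(ℝ, E) x →L[ℝ] TangentSpace 𝓘(ℝ, E) x) (p : M)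
    {y : E} (hy : y ∈ (Ch p).target) (v w : E) :
    coordMetric g p y (coordEndo J p y v) w
      = g ((Ch p).symm y) (J _ (dChartSymm p y v)) (dChartSymm p y w) := by
  rw [coordMetric_apply]
  have := congrArg (fun A ↦ A (J _ (dChartSymm p y v))) (dChartSymm_comp_dChart p hy)
  exact congrArg (fun a ↦ g ((Ch p).symm y) a (dChartSymm p y w)) this

theorem coordEndo_self
    (J : ∀ x : M, TangentSpace 𝓘(ℝ, E) x →L[ℝ] TangentSpace 𝓘(ℝ, E) x) (p : M) (v : E) :
    coordEndo J p (Ch p p) v = J p v := by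
  have h1 := apply_dChartSymm_self (fun x v _ ↦ dChart p x (J x v)) p v v
  refine Eq.trans h1 ?_
  simp only [dChart_self]
  rfl

/-- Smoothness of a bundle section is stated in trivialisations. The trivialisation of the tangent
bundle at `p` is the differential of the chart, so the local expression agrees with the chart
components. -/
theorem contDiffAt_coordMetric
    (g : Bundle.ContMDiffRiemannianMetric 𝓘(ℝ, E) ∞ E (fun x : M ↦ TangentSpace 𝓘(ℝ, E) x))
    (p : M) : ContDiffAt ℝ ∞ (coordMetric g.inner p) (Ch p p) := by
  have h := (contMDiffAt_hom_bundle _).1 (g.contMDiff p) |>.2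
  have hs : ContMDiffAt 𝓘(ℝ, E) 𝓘(ℝ, E) ∞ (Ch p).symm (Ch p p) :=
    (contMDiffOn_extChartAt_symm p).contMDiffAt (extChartAt_target_mem_nhds p)
  have h2 := (ContMDiffAt.comp (Ch p p) (by rwa [extChartAt_to_inv]) hs).contDiffAt
  refine h2.congr_of_eventuallyEq ?_
  filter_upwards [extChartAt_target_mem_nhds p] with y hy
  have hx := (Ch p).map_target hy
  have hx' : (Ch p).symm y ∈ (chartAt E p).source := by simpa using hx
  ext v w
  have e := dChartSymm_eq_symmL p hx
  rw [(Ch p).right_inv hy] at e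
  have e' : ∀ v : E, dChartSymm p y v
      = (trivializationAt E (TangentSpace 𝓘(ℝ, E)) p).symm ((Ch p).symm y) v := fun v ↦ by
    rw [dChartSymm, e, Bundle.Trivialization.symmL_apply]
    exact hx'
  rw [coordMetric_apply, e', e']
  simp only [Function.comp_apply]
  rw [inCoordinates_apply_eq₂ hx' hx' (Set.mem_univ _)]
  simp

theorem contDiffAt_coordEndo
    (J : ∀ x : M, TangentSpace 𝓘(ℝ, E) x →L[ℝ] TangentSpace 𝓘(ℝ, E) x)
    (hJ : ContMDiff 𝓘(ℝ, E) (𝓘(ℝ, E).prod 𝓘(ℝ, E →L[ℝ] E)) ∞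
      (fun x ↦ Bundle.TotalSpace.mk' (E →L[ℝ] E)
        (E := fun x : M ↦ TangentSpace 𝓘(ℝ, E) x →L[ℝ] TangentSpace 𝓘(ℝ, E) x) x (J x)))
    (p : M) : ContDiffAt ℝ ∞ (coordEndo J p) (Ch p p) := by
  have h := (contMDiffAt_hom_bundle _).1 (hJ p) |>.2
  have hs : ContMDiffAt 𝓘(ℝ, E) 𝓘(ℝ, E) ∞ (Ch p).symm (Ch p p) :=
    (contMDiffOn_extChartAt_symm p).contMDiffAt (extChartAt_target_mem_nhds p)
  have h2 := (ContMDiffAt.comp (Ch p p) (by rwa [extChartAt_to_inv]) hs).contDiffAt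
  refine h2.congr_of_eventuallyEq ?_
  filter_upwards [extChartAt_target_mem_nhds p] with y hy
  have hx := (Ch p).map_target hy
  have e := dChartSymm_eq_symmL p hx
  rw [(Ch p).right_inv hy] at e
  simp only [Function.comp_apply, ContinuousLinearMap.inCoordinates]
  rw [← dChart_eq_continuousLinearMapAt p hx, ← e]
  rfl

end Charts

/-! ### Nondegeneracy of positive forms -/

section Positive

theorem isInvertible_of_pos {E : Type*} [NormedAddCommGroup E] [NormedSpace ℝ E]
    [FiniteDimensional ℝ E] (A : E →L[ℝ] E →L[ℝ] ℝ) (hA : ∀ v, v ≠ 0 → 0 < A v v) :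
    A.IsInvertible := by
  have hinj : Function.Injective A := by
    rw [injective_iff_map_eq_zero]
    intro v hv
    by_contra h
    have := hA v h
    simp [hv] at this
  have hr : Module.finrank ℝ E = Module.finrank ℝ (E →L[ℝ] ℝ) := by
    rw [← (LinearMap.toContinuousLinearMap (𝕜 := ℝ) (E := E) (F' := ℝ)).finrank_eq]
    exact (Subspace.dual_finrank_eq (K := ℝ) (V := E)).symm
  refine ⟨(A.toLinearMap.linearEquivOfInjective hinj hr).toContinuousLinearEquiv, ?_⟩
  ext v w
  rfl

end Positive

/-! ### The Kähler structure in the chart around a point -/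

section KaehlerCharts

variable {E : Type*} [NormedAddCommGroup E] [NormedSpace ℝ E] [FiniteDimensional ℝ E]
  {M : Type*} [TopologicalSpace M] [ChartedSpace E M] [IsManifold 𝓘(ℝ, E) ∞ M]

theorem metricAt_coordMetric
    (g : Bundle.ContMDiffRiemannianMetric 𝓘(ℝ, E) ∞ E (fun x : M ↦ TangentSpace 𝓘(ℝ, E) x))
    (p : M) : MetricAt (coordMetric g.inner p) (extChartAt 𝓘(ℝ, E) p p) where
  contDiffAt := (contDiffAt_coordMetric g p).of_le ENat.LEInfty.out
  symm := Filter.Eventually.of_forall fun y v w ↦ g.symm _ _ _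
  isInvertible := isInvertible_of_pos _ fun v hv ↦ by
    rw [coordMetric_self]
    exact g.pos p v hv

omit [FiniteDimensional ℝ E] in
theorem IsKaehler.parallelAt
    {g : Bundle.ContMDiffRiemannianMetric 𝓘(ℝ, E) ∞ E (fun x : M ↦ TangentSpace 𝓘(ℝ, E) x)}
    {J : ∀ x : M, TangentSpace 𝓘(ℝ, E) x →L[ℝ] TangentSpace 𝓘(ℝ, E) x} (h : IsKaehler g J)
    (p : M) :
    ParallelAt (coordMetric g.inner p) (coordEndo J p) (extChartAt 𝓘(ℝ, E) p p) where
  contDiffAt := (contDiffAt_coordEndo J h.smooth p).of_le ENat.LEInfty.out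
  parallel := by
    filter_upwards [extChartAt_target_mem_nhds (I := 𝓘(ℝ, E)) p] with y hy v w
    simp only [christoffelMap_apply]
    exact h.parallel p y hy v w

omit [FiniteDimensional ℝ E] in
theorem riemann_eq (g : ∀ x : M, TangentSpace 𝓘(ℝ, E) x →L[ℝ] TangentSpace 𝓘(ℝ, E) x →L[ℝ] ℝ)
    (p : M) (X Y Z U : TangentSpace 𝓘(ℝ, E) p) :
    riemann g p X Y Z U = coordMetric g p (extChartAt 𝓘(ℝ, E) p p)
      (coordCurvature (coordMetric g p) (extChartAt 𝓘(ℝ, E) p p) X Y Z) U := by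
  simp only [riemann, dChart_self]
  rfl

end KaehlerCharts

/-! ### Immersions written in charts -/

section Immersion

variable {E : Type*} [NormedAddCommGroup E] [NormedSpace ℝ E] [FiniteDimensional ℝ E]
  {M : Type*} [TopologicalSpace M] [ChartedSpace E M] [IsManifold 𝓘(ℝ, E) ∞ M]
  {E' : Type*} [NormedAddCommGroup E'] [NormedSpace ℝ E'] [FiniteDimensional ℝ E']
  {N : Type*} [TopologicalSpace N] [ChartedSpace E' N] [IsManifold 𝓘(ℝ, E') ∞ N]
  {f : N → M}

omit [FiniteDimensional ℝ E] [IsManifold 𝓘(ℝ, E) ∞ M] [FiniteDimensional ℝ E']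
  [IsManifold 𝓘(ℝ, E') ∞ N] in
theorem contDiffAt_writtenInExtChartAt (hf : ContMDiff 𝓘(ℝ, E') 𝓘(ℝ, E) ∞ f) (q : N) :
    ContDiffAt ℝ ∞ (writtenInExtChartAt 𝓘(ℝ, E') 𝓘(ℝ, E) q f) (extChartAt 𝓘(ℝ, E') q q) := by
  have := ((contMDiffAt_iff (x := q)).1 (hf q)).2
  rwa [modelWithCornersSelf_coe, Set.range_id, contDiffWithinAt_univ] at this

omit [FiniteDimensional ℝ E] [FiniteDimensional ℝ E'] in
-- The chain rule for `chart⁻¹ ∘ φ = f ∘ chart⁻¹`. The map `P` is arbitrary so that the same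
-- statement serves the metric `g(·, ·)` and the form `g(J ·, ·)`.
theorem apply_dChartSymm_fderiv (hf : ContMDiff 𝓘(ℝ, E') 𝓘(ℝ, E) ∞ f) (q : N) {β : Type*}
    (P : ∀ x : M, TangentSpace 𝓘(ℝ, E) x → TangentSpace 𝓘(ℝ, E) x → β) :
    ∀ᶠ y in 𝓝 (extChartAt 𝓘(ℝ, E') q q), ∀ v w : E',
      writtenInExtChartAt 𝓘(ℝ, E') 𝓘(ℝ, E) q f y ∈ (extChartAt 𝓘(ℝ, E) (f q)).target ∧
      P ((extChartAt 𝓘(ℝ, E) (f q)).symm (writtenInExtChartAt 𝓘(ℝ, E') 𝓘(ℝ, E) q f y))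
        (dChartSymm (f q) (writtenInExtChartAt 𝓘(ℝ, E') 𝓘(ℝ, E) q f y)
          (fderiv ℝ (writtenInExtChartAt 𝓘(ℝ, E') 𝓘(ℝ, E) q f) y v))
        (dChartSymm (f q) (writtenInExtChartAt 𝓘(ℝ, E') 𝓘(ℝ, E) q f y)
          (fderiv ℝ (writtenInExtChartAt 𝓘(ℝ, E') 𝓘(ℝ, E) q f) y w))
        = P (f ((extChartAt 𝓘(ℝ, E') q).symm y))
          (mfderiv 𝓘(ℝ, E') 𝓘(ℝ, E) f _ (dChartSymm q y v))
          (mfderiv 𝓘(ℝ, E') 𝓘(ℝ, E) f _ (dChartSymm q y w)) := by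
  set φ := writtenInExtChartAt 𝓘(ℝ, E') 𝓘(ℝ, E) q f with hφ
  have hN := isManifold_one (E := E') (M := N)
  have hM := isManifold_one (E := E) (M := M)
  have h1 : ∀ᶠ y in 𝓝 (extChartAt 𝓘(ℝ, E') q q),
      f ((extChartAt 𝓘(ℝ, E') q).symm y) ∈ (extChartAt 𝓘(ℝ, E) (f q)).source := by
    have hc : ContinuousAt (fun y ↦ f ((extChartAt 𝓘(ℝ, E') q).symm y))
        (extChartAt 𝓘(ℝ, E') q q) :=
      ContinuousAt.comp (g := f) (hf.continuous.continuousAt) (continuousAt_extChartAt_symm q)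
    apply hc.preimage_mem_nhds
    rw [extChartAt_to_inv]
    exact extChartAt_source_mem_nhds (f q)
  have h2 : ∀ᶠ y in 𝓝 (extChartAt 𝓘(ℝ, E') q q), ContDiffAt ℝ 1 φ y :=
    ((contDiffAt_writtenInExtChartAt hf q).of_le ENat.LEInfty.out).eventually (by simp)
  filter_upwards [h1.eventually_nhds, extChartAt_target_mem_nhds (I := 𝓘(ℝ, E')) q, h2]
    with y hy hyt hyφ v w
  have hy0 := hy.self_of_nhds
  have ht : φ y ∈ (extChartAt 𝓘(ℝ, E) (f q)).target := (extChartAt 𝓘(ℝ, E) (f q)).map_source hy0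
  refine ⟨ht, ?_⟩
  have hpt : (extChartAt 𝓘(ℝ, E) (f q)).symm (φ y) = f ((extChartAt 𝓘(ℝ, E') q).symm y) :=
    (extChartAt 𝓘(ℝ, E) (f q)).left_inv hy0
  have heq : (extChartAt 𝓘(ℝ, E) (f q)).symm ∘ φ =ᶠ[𝓝 y] f ∘ (extChartAt 𝓘(ℝ, E') q).symm := by
    filter_upwards [hy] with y' hy'
    exact (extChartAt 𝓘(ℝ, E) (f q)).left_inv hy'
  have hs : MDifferentiableAt 𝓘(ℝ, E) 𝓘(ℝ, E) (extChartAt 𝓘(ℝ, E) (f q)).symm (φ y) := by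
    have := mdifferentiableWithinAt_extChartAt_symm (I := 𝓘(ℝ, E)) ht
    rwa [modelWithCornersSelf_coe, Set.range_id, mdifferentiableWithinAt_univ] at this
  have hs' : MDifferentiableAt 𝓘(ℝ, E') 𝓘(ℝ, E') (extChartAt 𝓘(ℝ, E') q).symm y := by
    have := mdifferentiableWithinAt_extChartAt_symm (I := 𝓘(ℝ, E')) hyt
    rwa [modelWithCornersSelf_coe, Set.range_id, mdifferentiableWithinAt_univ] at this
  have hd : MDifferentiableAt 𝓘(ℝ, E') 𝓘(ℝ, E) φ y :=
    (hyφ.differentiableAt (by simp)).mdifferentiableAt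
  have hfd : MDifferentiableAt 𝓘(ℝ, E') 𝓘(ℝ, E) f ((extChartAt 𝓘(ℝ, E') q).symm y) :=
    (hf _).mdifferentiableAt (by simp)
  have e1 := mfderiv_comp y hs hd
  have e2 := mfderiv_comp y hfd hs'
  have e3 := heq.mfderiv_eq (I := 𝓘(ℝ, E')) (I' := 𝓘(ℝ, E))
  rw [mfderiv_eq_fderiv] at e1
  have key : ∀ v : E', (dChartSymm (f q) (φ y) (fderiv ℝ φ y v) : E)
      = (mfderiv 𝓘(ℝ, E') 𝓘(ℝ, E) f ((extChartAt 𝓘(ℝ, E') q).symm y) (dChartSymm q y v) : E) := by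
    intro v
    have a1 : (mfderiv 𝓘(ℝ, E') 𝓘(ℝ, E) ((extChartAt 𝓘(ℝ, E) (f q)).symm ∘ φ) y : E' →L[ℝ] E) v
      = (dChartSymm (f q) (φ y) (fderiv ℝ φ y v) : E) := by rw [e1]; rfl
    have a2 : (mfderiv 𝓘(ℝ, E') 𝓘(ℝ, E) (f ∘ (extChartAt 𝓘(ℝ, E') q).symm) y : E' →L[ℝ] E) v
      = (mfderiv 𝓘(ℝ, E') 𝓘(ℝ, E) f ((extChartAt 𝓘(ℝ, E') q).symm y) (dChartSymm q y v) : E) := by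
      rw [e2]; rfl
    rw [← a1, ← a2]
    exact congrArg (fun A : E' →L[ℝ] E ↦ A v) e3
  let P' : M → E → E → β := fun x a b ↦ P x a b
  change P' _ (dChartSymm (f q) (φ y) (fderiv ℝ φ y v) : E)
    (dChartSymm (f q) (φ y) (fderiv ℝ φ y w) : E) = P' _ (mfderiv 𝓘(ℝ, E') 𝓘(ℝ, E) f
      ((extChartAt 𝓘(ℝ, E') q).symm y) (dChartSymm q y v) : E) (mfderiv 𝓘(ℝ, E') 𝓘(ℝ, E) f
      ((extChartAt 𝓘(ℝ, E') q).symm y) (dChartSymm q y w) : E)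
  rw [key, key, hpt]

variable {g : Bundle.ContMDiffRiemannianMetric 𝓘(ℝ, E) ∞ E (fun x : M ↦ TangentSpace 𝓘(ℝ, E) x)}
  {J : ∀ x : M, TangentSpace 𝓘(ℝ, E) x →L[ℝ] TangentSpace 𝓘(ℝ, E) x}

omit [FiniteDimensional ℝ E] [IsManifold 𝓘(ℝ, E) ∞ M] [FiniteDimensional ℝ E']
  [IsManifold 𝓘(ℝ, E') ∞ N] in
theorem writtenInExtChartAt_self (f : N → M) (q : N) :
    writtenInExtChartAt 𝓘(ℝ, E') 𝓘(ℝ, E) q f (extChartAt 𝓘(ℝ, E') q q)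
      = extChartAt 𝓘(ℝ, E) (f q) (f q) := by
  rw [writtenInExtChartAt, Function.comp_apply, Function.comp_apply, extChartAt_to_inv]

theorem IsLagrangianImmersion.isometryAt
    (h : IsLagrangianImmersion (E' := E') g.inner J f) (q : N) :
    IsometryAt (coordMetric (inducedMetric g.inner f) q) (coordMetric g.inner (f q))
      (writtenInExtChartAt 𝓘(ℝ, E') 𝓘(ℝ, E) q f) (extChartAt 𝓘(ℝ, E') q q) := by
  set φ := writtenInExtChartAt 𝓘(ℝ, E') 𝓘(ℝ, E) q f with hφ
  have hz : φ (extChartAt 𝓘(ℝ, E') q q) = extChartAt 𝓘(ℝ, E) (f q) (f q) :=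
    writtenInExtChartAt_self f q
  have hm : MetricAt (coordMetric g.inner (f q)) (φ (extChartAt 𝓘(ℝ, E') q q)) := by
    rw [hz]; exact metricAt_coordMetric g (f q)
  have hφs := contDiffAt_writtenInExtChartAt h.smooth q
  have heq : ∀ᶠ y in 𝓝 (extChartAt 𝓘(ℝ, E') q q), ∀ v w,
      coordMetric (inducedMetric g.inner f) q y v w
        = coordMetric g.inner (f q) (φ y) (fderiv ℝ φ y v) (fderiv ℝ φ y w) := by
    filter_upwards [apply_dChartSymm_fderiv h.smooth q (fun x a b ↦ g.inner x a b)] with y hy v w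
    exact (hy v w).2.symm
  refine ⟨hm, ⟨?_, ?_, ?_⟩, hφs.of_le ENat.LEInfty.out, heq⟩
  -- Regularity of the induced metric is read off from the pullback formula `φ^* G`. One derivative
  -- of `φ` is spent, hence order 3 for `φ`.
  · have h1 : ContDiffAt ℝ 2 (fderiv ℝ φ) (extChartAt 𝓘(ℝ, E') q q) :=
      (hφs.of_le (n := ∞) (m := 3) ENat.LEInfty.out).fderiv_right (by norm_num)
    have h2 : ContDiffAt ℝ 2 (fun y ↦ coordMetric g.inner (f q) (φ y))
        (extChartAt 𝓘(ℝ, E') q q) :=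
      hm.contDiffAt.comp _ (hφs.of_le ENat.LEInfty.out)
    have h3 : ContDiffAt ℝ 2 (fun y ↦ ((ContinuousLinearMap.compL ℝ E' E ℝ).flip
        (fderiv ℝ φ y)).comp ((coordMetric g.inner (f q) (φ y)).comp (fderiv ℝ φ y)))
        (extChartAt 𝓘(ℝ, E') q q) :=
      ((ContinuousLinearMap.compL ℝ E' E ℝ).flip.contDiff.contDiffAt.comp _ h1).clm_comp
        (h2.clm_comp h1)
    refine h3.congr_of_eventuallyEq ?_
    filter_upwards [heq] with y hy
    ext v w
    rw [hy]
    rfl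
  · exact Filter.Eventually.of_forall fun y v w ↦ g.symm _ _ _
  · refine isInvertible_of_pos _ fun v hv ↦ ?_
    rw [coordMetric_self]
    refine g.pos (f q) (mfderiv 𝓘(ℝ, E') 𝓘(ℝ, E) f q v) fun h0 ↦ hv ?_
    exact h.immersion q (h0.trans (map_zero _).symm)

omit [FiniteDimensional ℝ E] [FiniteDimensional ℝ E'] in
theorem IsLagrangianImmersion.eventually_normal
    (h : IsLagrangianImmersion (E' := E') g.inner J f) (q : N) :
    ∀ᶠ y in 𝓝 (extChartAt 𝓘(ℝ, E') q q), ∀ v w,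
      coordMetric g.inner (f q) (writtenInExtChartAt 𝓘(ℝ, E') 𝓘(ℝ, E) q f y)
        (coordEndo J (f q) (writtenInExtChartAt 𝓘(ℝ, E') 𝓘(ℝ, E) q f y)
          (fderiv ℝ (writtenInExtChartAt 𝓘(ℝ, E') 𝓘(ℝ, E) q f) y v))
        (fderiv ℝ (writtenInExtChartAt 𝓘(ℝ, E') 𝓘(ℝ, E) q f) y w) = 0 := by
  filter_upwards [apply_dChartSymm_fderiv h.smooth q (fun x a b ↦ g.inner x (J x a) b)]
    with y hy v w
  rw [coordMetric_coordEndo g.inner J (f q) (hy v w).1, (hy v w).2]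
  exact h.normal _ _ _

end Immersion

/-! ### Algebraic Kähler curvature tensors -/

section KaehlerCurvature

variable {V : Type*} [AddCommGroup V] [Module ℝ V]

/-- Quadrilinear forms with the symmetries of the curvature tensor of a Kähler manifold. -/
structure IsKaehlerCurvature (J : V → V) (T : V → V → V → V → ℝ) : Prop where
  add_left : ∀ x x' y z u, T (x + x') y z u = T x y z u + T x' y z u
  smul_left : ∀ (c : ℝ) x y z u, T (c • x) y z u = c * T x y z u
  swap_left : ∀ x y z u, T x y z u = -T y x z u
  swap_right : ∀ x y z u, T x y z u = -T x y u z
  bianchi : ∀ x y z u, T x y z u + T y z x u + T z x y u = 0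
  invariant : ∀ x y z u, T x y (J z) (J u) = T x y z u

namespace IsKaehlerCurvature

variable {J : V → V} {T S : V → V → V → V → ℝ}

theorem linear_comb {P Q R : V → V → V → V → ℝ} (h : IsKaehlerCurvature J T)
    (hP : IsKaehlerCurvature J P) (hQ : IsKaehlerCurvature J Q) (hR : IsKaehlerCurvature J R)
    (a b c : ℝ) : IsKaehlerCurvature J
      (fun x y z u ↦ T x y z u - (a * P x y z u + b * Q x y z u + c * R x y z u)) where
  add_left x x' y z u := by
    rw [h.add_left, hP.add_left, hQ.add_left, hR.add_left]; ring
  smul_left r x y z u := by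
    rw [h.smul_left, hP.smul_left, hQ.smul_left, hR.smul_left]; ring
  swap_left x y z u := by
    rw [h.swap_left, hP.swap_left, hQ.swap_left, hR.swap_left]; ring
  swap_right x y z u := by
    rw [h.swap_right, hP.swap_right, hQ.swap_right, hR.swap_right]; ring
  bianchi x y z u := by
    linear_combination h.bianchi x y z u - a * hP.bianchi x y z u - b * hQ.bianchi x y z u
      - c * hR.bianchi x y z u
  invariant x y z u := by
    rw [h.invariant, hP.invariant, hQ.invariant, hR.invariant]

/-- The octahedron argument: four Bianchi identities combined with the two antisymmetries. -/
theorem pair_symm (h : IsKaehlerCurvature J T) (x y z u : V) : T x y z u = T z u x y := by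
  linarith [h.bianchi x y z u, h.bianchi y z u x, h.bianchi z u x y, h.bianchi u x y z,
    h.swap_right x y u z, h.swap_right y z x u, h.swap_right z x y u, h.swap_right u x y z,
    h.swap_left x y z u, h.swap_left u x y z, h.swap_right z u x y, h.swap_right u y z x,
    h.swap_left y u z x, h.swap_left z x y u, h.swap_right z x y u, h.swap_left x z u y,
    h.swap_left u y z x, h.swap_right y u z x]

theorem invariant_left (h : IsKaehlerCurvature J T) (x y z u : V) :
    T (J x) (J y) z u = T x y z u := by
  rw [h.pair_symm, h.invariant, h.pair_symm]

theorem add_two (h : IsKaehlerCurvature J T) (x y y' z u : V) :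
    T x (y + y') z u = T x y z u + T x y' z u := by
  rw [h.swap_left, h.add_left, h.swap_left x y, h.swap_left x y']; ring

theorem smul_two (h : IsKaehlerCurvature J T) (c : ℝ) (x y z u : V) :
    T x (c • y) z u = c * T x y z u := by
  rw [h.swap_left, h.smul_left, h.swap_left x y]; ring

theorem add_three (h : IsKaehlerCurvature J T) (x y z z' u : V) :
    T x y (z + z') u = T x y z u + T x y z' u := by
  rw [h.pair_symm, h.add_left, h.pair_symm z, h.pair_symm z']

theorem smul_three (h : IsKaehlerCurvature J T) (c : ℝ) (x y z u : V) :
    T x y (c • z) u = c * T x y z u := by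
  rw [h.pair_symm, h.smul_left, h.pair_symm z]

theorem add_four (h : IsKaehlerCurvature J T) (x y z u u' : V) :
    T x y z (u + u') = T x y z u + T x y z u' := by
  rw [h.swap_right, h.add_three, h.swap_right x y z u, h.swap_right x y z u']; ring

theorem smul_four (h : IsKaehlerCurvature J T) (c : ℝ) (x y z u : V) :
    T x y z (c • u) = c * T x y z u := by
  rw [h.swap_right, h.smul_three, h.swap_right x y z u]; ring

/-- The holomorphic sectional curvature on a plane is a binary quartic form. -/
theorem holomorphic_comb (h : IsKaehlerCurvature J T) (hadd : ∀ x y, J (x + y) = J x + J y)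
    (hsmul : ∀ (c : ℝ) x, J (c • x) = c • J x) (x y : V) (r s : ℝ) :
    T (r • x + s • y) (J (r • x + s • y)) (J (r • x + s • y)) (r • x + s • y)
      = r ^ 4 * T x (J x) (J x) x
        + r ^ 3 * s * (T y (J x) (J x) x + T x (J y) (J x) x + T x (J x) (J y) x
          + T x (J x) (J x) y)
        + r ^ 2 * s ^ 2 * (T y (J y) (J x) x + T y (J x) (J y) x + T y (J x) (J x) y
          + T x (J y) (J y) x + T x (J y) (J x) y + T x (J x) (J y) y)
        + r * s ^ 3 * (T x (J y) (J y) y + T y (J x) (J y) y + T y (J y) (J x) y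
          + T y (J y) (J y) x)
        + s ^ 4 * T y (J y) (J y) y := by
  simp only [hadd, hsmul, h.add_left, h.add_two, h.add_three, h.add_four, h.smul_left, h.smul_two,
    h.smul_three, h.smul_four]
  ring

/-- Evaluating on `x + y` and `x - y` and adding kills the `r² s²` coefficient of
`holomorphic_comb`. By `J`-invariance and Bianchi it equals `6 T(x,Jy,Jy,x) + 2 T(x,y,y,x)`.
Replacing `y` by `Jy` swaps the two values, and the resulting 2×2 system is nonsingular. -/
theorem sectional_eq_zero (h : IsKaehlerCurvature J T) (hadd : ∀ x y, J (x + y) = J x + J y)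
    (hsmul : ∀ (c : ℝ) x, J (c • x) = c • J x) (hJ : ∀ x, J (J x) = -x)
    (hT : ∀ x, T x (J x) (J x) x = 0) (x y : V) : T x y y x = 0 := by
  have hneg2 : ∀ x y z u, T x (-y) z u = -T x y z u := fun x y z u ↦ by
    rw [← neg_one_smul ℝ y, h.smul_two]; ring
  have hneg3 : ∀ x y z u, T x y (-z) u = -T x y z u := fun x y z u ↦ by
    rw [← neg_one_smul ℝ z, h.smul_three]; ring
  have key : ∀ x y, 3 * T x (J y) (J y) x + T x y y x = 0 := by
    intro x y
    have e1 := h.holomorphic_comb hadd hsmul x y 1 1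
    have e2 := h.holomorphic_comb hadd hsmul x y 1 (-1)
    rw [hT, hT, hT] at e1 e2
    have q1 : T y (J y) (J x) x = T x (J x) (J y) y := by
      rw [h.pair_symm, h.swap_left, h.swap_right]; ring
    have q5 : T x (J y) (J x) y = T x (J y) (J y) x := by
      have := h.invariant x (J y) (J x) y
      rw [hJ, hneg3, h.swap_right x (J y) x] at this
      linarith
    have q3 : T y (J x) (J x) y = T x (J y) (J y) x := by
      have e := h.invariant_left y (J x) (J x) y
      have e' := h.pair_symm x (J y) (J y) x
      rw [hJ, hneg2, h.swap_left (J y) x] at e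
      linarith
    have q2 : T y (J x) (J y) x = T y (J x) (J x) y := by
      have := h.invariant y (J x) (J y) x
      rw [hJ, hneg3, h.swap_right y (J x) y] at this
      linarith
    have b := h.bianchi x (J x) (J y) y
    rw [h.invariant_left, h.swap_left (J y) x, h.swap_right x y x y] at b
    linarith
  have k1 := key x y
  have k2 := key x (J y)
  rw [hJ, hneg2, hneg3] at k2
  linarith

/-- Polarise the sectional curvature, first in `x`, then in `y`. The tensor becomes antisymmetric in
its middle slots as well, and Bianchi then reads `3T = 0`. -/
theorem eq_zero (h : IsKaehlerCurvature J T) (hadd : ∀ x y, J (x + y) = J x + J y)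
    (hsmul : ∀ (c : ℝ) x, J (c • x) = c • J x) (hJ : ∀ x, J (J x) = -x)
    (hT : ∀ x, T x (J x) (J x) x = 0) (x y z u : V) : T x y z u = 0 := by
  have s := h.sectional_eq_zero hadd hsmul hJ hT
  have p1 : ∀ x y u, T x y y u = 0 := by
    intro x y u
    have e := s (x + u) y
    have q : T u y y x = T x y y u := by
      rw [h.pair_symm, h.swap_left, h.swap_right]; ring
    rw [h.add_left, h.add_four, h.add_four, s, s, q] at e
    linarith
  have p2 : ∀ x y z u, T x y z u = -T x z y u := by
    intro x y z u
    have e := p1 x (y + z) u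
    rw [h.add_two, h.add_three, h.add_three, p1, p1] at e
    linarith
  linarith [h.bianchi x y z u, p2 x y z u, p2 y z x u, h.swap_left z x y u, h.swap_left y x z u,
    h.swap_left x y z u]

end IsKaehlerCurvature

end KaehlerCurvature

/-! ### Decomposition of the curvature of a QCH-manifold -/

section QuasiConstant

variable {E : Type*} [NormedAddCommGroup E] [NormedSpace ℝ E]
  {M : Type*} [TopologicalSpace M] [ChartedSpace E M] [IsManifold 𝓘(ℝ, E) ∞ M]
  {g : Bundle.ContMDiffRiemannianMetric 𝓘(ℝ, E) ∞ E (fun x : M ↦ TangentSpace 𝓘(ℝ, E) x)}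
  {J : ∀ x : M, TangentSpace 𝓘(ℝ, E) x →L[ℝ] TangentSpace 𝓘(ℝ, E) x}
  {D : ∀ x : M, Submodule ℝ (TangentSpace 𝓘(ℝ, E) x)}

theorem IsKaehler.skew (h : IsKaehler g J) {p : M} (X Y : TangentSpace 𝓘(ℝ, E) p) :
    g.inner p X (J p Y) = -g.inner p (J p X) Y := by
  rw [← h.orthogonal p X, h.sq, map_neg]

theorem IsKaehler.alternating (h : IsKaehler g J) {p : M} (X Y : TangentSpace 𝓘(ℝ, E) p) :
    g.inner p (J p X) Y = -g.inner p (J p Y) X := by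
  rw [g.symm p (J p Y) X, h.skew, neg_neg]

theorem IsKaehler.apply_self (h : IsKaehler g J) {p : M} (X : TangentSpace 𝓘(ℝ, E) p) :
    g.inner p (J p X) X = 0 := by
  linarith [h.alternating X X]

theorem MetricAt.isKaehlerCurvature {V : Type*} [NormedAddCommGroup V] [NormedSpace ℝ V]
    [CompleteSpace V] {G : V → V →L[ℝ] V →L[ℝ] ℝ} {𝒥 : V → V →L[ℝ] V} {z : V} (h : MetricAt G z)
    (hJ : ParallelAt G 𝒥 z) (ho : ∀ v w, G z (𝒥 z v) (𝒥 z w) = G z v w) :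
    IsKaehlerCurvature (𝒥 z) (fun x y w u ↦ G z (coordCurvature G z x y w) u) where
  add_left x x' y w u := by
    simp only [h.coordCurvature_add_left, map_add, add_apply]
  smul_left c x y w u := by
    simp only [h.coordCurvature_smul_left, map_smul, smul_apply, smul_eq_mul]
  swap_left x y w u := by
    simp only [MetricAt.coordCurvature_swap x y, map_neg, neg_apply]
  swap_right x y w u := h.apply_coordCurvature_swap _ _ _ _
  bianchi x y w u := by
    simp only [← add_apply, ← map_add, h.coordCurvature_bianchi, map_zero, zero_apply]
  invariant x y w u := by
    simp only [hJ.coordCurvature_apply h, ho]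

theorem isKaehlerCurvature_riemann [FiniteDimensional ℝ E] (h : IsKaehler g J) (p : M) :
    IsKaehlerCurvature (V := TangentSpace 𝓘(ℝ, E) p) (J p) (riemann g.inner p) := by
  have key := (metricAt_coordMetric g p).isKaehlerCurvature (h.parallelAt p) (fun v w ↦ by
    rw [coordEndo_self, coordEndo_self]
    exact (coordMetric_self _ _ _ _).trans
      ((h.orthogonal p v w).trans (coordMetric_self _ _ _ _).symm))
  have eJ : (coordEndo J p (extChartAt 𝓘(ℝ, E) p p) : E → E) = (J p : E →L[ℝ] E) :=
    funext (coordEndo_self J p)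
  rw [eJ] at key
  have eR : riemann g.inner p = fun x y w u : E ↦ coordMetric g.inner p (extChartAt 𝓘(ℝ, E) p p)
      (coordCurvature (coordMetric g.inner p) (extChartAt 𝓘(ℝ, E) p p) x y w) u := by
    funext x y w u
    exact riemann_eq _ _ _ _ _ _
  rw [eR]
  exact key

theorem isKaehlerCurvature_piTensor (h : IsKaehler g J) (p : M) :
    IsKaehlerCurvature (V := TangentSpace 𝓘(ℝ, E) p) (J p) (piTensor g J) := by
  refine ⟨fun x x' y z u ↦ ?_, fun c x y z u ↦ ?_, fun x y z u ↦ ?_, fun x y z u ↦ ?_,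
    fun x y z u ↦ ?_, fun x y z u ↦ ?_⟩
  · simp only [piTensor, map_add, add_apply]; ring
  · simp only [piTensor, map_smul, smul_apply, smul_eq_mul]; ring
  · simp only [piTensor, h.alternating y x]; ring
  · simp only [piTensor, h.alternating u z]; ring
  · simp only [piTensor, h.alternating y x, h.alternating z x, h.alternating z y, g.symm p y x,
      g.symm p z x, g.symm p z y]
    ring
  · simp only [piTensor, h.orthogonal, h.skew, h.sq, map_neg, neg_apply]
    ring

theorem isKaehlerCurvature_phiTensor (h : IsKaehler g J) {p : M} (ξ : TangentSpace 𝓘(ℝ, E) p) :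
    IsKaehlerCurvature (V := TangentSpace 𝓘(ℝ, E) p) (J p) (phiTensor g J ξ) := by
  refine ⟨fun x x' y z u ↦ ?_, fun c x y z u ↦ ?_, fun x y z u ↦ ?_, fun x y z u ↦ ?_,
    fun x y z u ↦ ?_, fun x y z u ↦ ?_⟩
  · simp only [phiTensor, eta, map_add, add_apply]; ring
  · simp only [phiTensor, eta, map_smul, smul_apply, smul_eq_mul]; ring
  · simp only [phiTensor, eta, h.alternating y x]; ring
  · simp only [phiTensor, eta, h.alternating u z]; ring
  · simp only [phiTensor, eta, h.alternating y x, h.alternating z x, h.alternating z y,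
      g.symm p y x, g.symm p z x, g.symm p z y]
    ring
  · simp only [phiTensor, eta, h.orthogonal, h.skew, h.sq, map_neg, neg_apply]
    ring

theorem isKaehlerCurvature_psiTensor (h : IsKaehler g J) {p : M} (ξ : TangentSpace 𝓘(ℝ, E) p) :
    IsKaehlerCurvature (V := TangentSpace 𝓘(ℝ, E) p) (J p) (psiTensor g J ξ) := by
  refine ⟨fun x x' y z u ↦ ?_, fun c x y z u ↦ ?_, fun x y z u ↦ ?_, fun x y z u ↦ ?_,
    fun x y z u ↦ ?_, fun x y z u ↦ ?_⟩
  · simp only [psiTensor, eta, map_add]; ring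
  · simp only [psiTensor, eta, map_smul, smul_eq_mul]; ring
  · simp only [psiTensor]; ring
  · simp only [psiTensor]; ring
  · simp only [psiTensor]; ring
  · simp only [psiTensor, eta, h.orthogonal, h.skew]
    ring

/-- The three tensors realise the monomials `1`, `t`, `t²` in `t = η(X)² + η̃(X)²`, so matching a
quadratic polynomial in `t` determines `a`, `b`, `c`. -/
theorem holomorphic_comb_tensors (h : IsKaehler g J) {p : M} (ξ X : TangentSpace 𝓘(ℝ, E) p)
    (hX : g.inner p X X = 1) (a b c : ℝ) :
    a * piTensor g J X (J p X) (J p X) X + b * phiTensor g J ξ X (J p X) (J p X) X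
      + c * psiTensor g J ξ X (J p X) (J p X) X
      = a + b * (eta g ξ X ^ 2 + eta g (J p ξ) X ^ 2)
        + c * (eta g ξ X ^ 2 + eta g (J p ξ) X ^ 2) ^ 2 := by
  simp only [piTensor, phiTensor, psiTensor, eta, h.orthogonal, h.skew, h.sq, map_neg, neg_apply,
    h.apply_self, hX]
  ring

theorem eta_sq_add_le_one (h : IsKaehler g J) {p : M} {ξ X : TangentSpace 𝓘(ℝ, E) p}
    (hξ : g.inner p ξ ξ = 1) (hX : g.inner p X X = 1) :
    eta g ξ X ^ 2 + eta g (J p ξ) X ^ 2 ≤ 1 := by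
  set α := eta g ξ X with hα
  set β := eta g (J p ξ) X with hβ
  have hnn : 0 ≤ g.inner p (X - α • ξ - β • J p ξ) (X - α • ξ - β • J p ξ) := by
    by_cases h0 : X - α • ξ - β • J p ξ = 0
    · rw [h0]; simp
    · exact (g.pos p _ h0).le
  have e1 : g.inner p ξ X = α := rfl
  have e2 : g.inner p (J p ξ) X = β := rfl
  simp only [map_sub, map_smul, sub_apply, smul_apply, smul_eq_mul, hX, hξ, h.orthogonal,
    h.apply_self, g.symm p X ξ, g.symm p X (J p ξ), g.symm p ξ (J p ξ), e1, e2] at hnn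
  nlinarith

/-- Averaging over `(r, s)` and `(r, -s)` removes the odd terms; substituting `s² = 1 - r²` leaves a
quadratic in `t = r²`. The coefficients come from interpolation at `0`, `1/2`, `1`. -/
theorem quadratic_of_quartic {F : ℝ → ℝ} {A B C B' E : ℝ}
    (hF : ∀ r s : ℝ, r ^ 2 + s ^ 2 = 1 →
      F (r ^ 2) = r ^ 4 * A + r ^ 3 * s * B + r ^ 2 * s ^ 2 * C + r * s ^ 3 * B' + s ^ 4 * E)
    {t : ℝ} (h0 : 0 ≤ t) (h1 : t ≤ 1) :
    F t = F 0 + (4 * F (1 / 2) - F 1 - 3 * F 0) * t + (2 * F 1 + 2 * F 0 - 4 * F (1 / 2)) * t ^ 2 := by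
  have key : ∀ t : ℝ, 0 ≤ t → t ≤ 1 → F t = t ^ 2 * A + t * (1 - t) * C + (1 - t) ^ 2 * E := by
    intro t h0 h1
    have hr := Real.sq_sqrt h0
    have hs := Real.sq_sqrt (sub_nonneg.2 h1)
    have e1 := hF (√t) (√(1 - t)) (by rw [hr, hs]; ring)
    have e2 := hF (√t) (-√(1 - t)) (by rw [neg_sq, hr, hs]; ring)
    have r4 : √t ^ 4 = t ^ 2 := by rw [← hr]; ring_nf; rw [hr]
    have s4 : √(1 - t) ^ 4 = (1 - t) ^ 2 := by
      calc √(1 - t) ^ 4 = (√(1 - t) ^ 2) ^ 2 := by ring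
        _ = _ := by rw [hs]
    rw [hr] at e1 e2
    have s4' : (-√(1 - t)) ^ 4 = (1 - t) ^ 2 := by rw [← s4]; ring
    rw [r4, hs, s4] at e1
    rw [r4, neg_sq, hs, s4'] at e2
    linarith
  rw [key t h0 h1, key 0 le_rfl zero_le_one, key 1 zero_le_one le_rfl,
    key (1 / 2) (by norm_num) (by norm_num)]
  ring

theorem exists_unit_mem (hD : IsHolomorphicDistribution g J D)
    (hE : 2 < Module.finrank ℝ E) (p : M) : ∃ v ∈ D p, g.inner p v v = 1 := by
  have h1 : Module.finrank ℝ (D p) + 2 = Module.finrank ℝ E := hD.codim p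
  have h2 : D p ≠ ⊥ := by
    intro h0
    rw [h0, finrank_bot] at h1
    omega
  obtain ⟨v, hv, hv0⟩ := (D p).exists_mem_ne_zero_of_ne_bot h2
  have hpos := g.pos p v hv0
  refine ⟨(√(g.inner p v v))⁻¹ • v, (D p).smul_mem _ hv, ?_⟩
  have := Real.mul_self_sqrt hpos.le
  have hne := (Real.sqrt_pos.2 hpos).ne'
  rw [map_smul, map_smul, smul_apply, smul_eq_mul, smul_eq_mul]
  field_simp
  nlinarith

theorem exists_hasCurvatureFunctions [FiniteDimensional ℝ E] (hE : 2 < Module.finrank ℝ E)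
    (hK : IsKaehler g J) (hD : IsHolomorphicDistribution g J D) (hQ : IsQCH g J D) :
    ∃ a b c : M → ℝ, HasCurvatureFunctions g J D a b c := by
  obtain ⟨F, hF⟩ := hQ
  -- The curvature function reparametrised by `t = cos²φ`. It does not involve `ξ`, so the resulting
  -- `a`, `b`, `c` serve every unit normal.
  let Q : M → ℝ → ℝ := fun p t ↦ F p (Real.arccos (√t))
  refine ⟨fun p ↦ Q p 0, fun p ↦ 4 * Q p (1 / 2) - Q p 1 - 3 * Q p 0,
    fun p ↦ 2 * Q p 1 + 2 * Q p 0 - 4 * Q p (1 / 2), fun p ξ hξ ↦ ?_⟩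
  have hQF : ∀ X : TangentSpace 𝓘(ℝ, E) p, g.inner p X X = 1 →
      riemann g.inner p X (J p X) (J p X) X = Q p (eta g ξ X ^ 2 + eta g (J p ξ) X ^ 2) :=
    fun X hX ↦ hF p ξ X hξ hX
  have hR := isKaehlerCurvature_riemann hK p
  obtain ⟨v, hv, hv1⟩ := exists_unit_mem hD hE p
  have hξv : g.inner p ξ v = 0 := hξ.2 v hv
  have hξv' : g.inner p (J p ξ) v = 0 := by
    rw [← neg_eq_zero, ← hK.skew]; exact hξ.2 _ (hD.invariant p v hv)
  have hquad : ∀ t : ℝ, 0 ≤ t → t ≤ 1 → Q p t = Q p 0 + (4 * Q p (1 / 2) - Q p 1 - 3 * Q p 0) * t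
      + (2 * Q p 1 + 2 * Q p 0 - 4 * Q p (1 / 2)) * t ^ 2 := by
    intro t h0 h1
    -- The coefficients are left open; unification with `holomorphic_comb` for the pair `ξ`, `v`
    -- supplies them.
    refine quadratic_of_quartic (A := ?A) (B := ?B) (C := ?C) (B' := ?B') (E := ?E) ?hF h0 h1
    case hF =>
      intro r s hrs
      have h1 : g.inner p (r • ξ + s • v) (r • ξ + s • v) = 1 := by
        simp only [map_add, map_smul, add_apply, smul_apply, smul_eq_mul, hξ.1, hv1, hξv,
          g.symm p v ξ]
        linarith
      have h2 : eta g ξ (r • ξ + s • v) = r := by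
        simp only [eta, map_add, map_smul, smul_eq_mul, hξ.1, hξv]; ring
      have h3 : eta g (J p ξ) (r • ξ + s • v) = 0 := by
        simp only [eta, map_add, map_smul, smul_eq_mul, hK.apply_self, hξv']; ring
      have e := hQF _ h1
      rw [h2, h3, hR.holomorphic_comb (map_add _) (map_smul _), zero_pow two_ne_zero,
        add_zero] at e
      exact e.symm
  intro X Y Z U
  have hT := hR.linear_comb (isKaehlerCurvature_piTensor hK p) (isKaehlerCurvature_phiTensor hK ξ)
    (isKaehlerCurvature_psiTensor hK ξ) (Q p 0) (4 * Q p (1 / 2) - Q p 1 - 3 * Q p 0)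
    (2 * Q p 1 + 2 * Q p 0 - 4 * Q p (1 / 2))
  have := hT.eq_zero (map_add _) (map_smul _) (hK.sq p) ?_ X Y Z U
  · exact sub_eq_zero.1 this
  intro X
  by_cases hX : X = 0
  · subst hX
    have := hT.smul_left 0 0 (J p 0) (J p 0) 0
    rwa [zero_smul, zero_mul] at this
  have hpos := g.pos p X hX
  set ρ := √(g.inner p X X) with hρ
  have hρ0 : ρ ≠ 0 := (Real.sqrt_pos.2 hpos).ne'
  have hρ2 : ρ * ρ = g.inner p X X := Real.mul_self_sqrt hpos.le
  obtain ⟨W, hW⟩ : ∃ W, W = ρ⁻¹ • X := ⟨_, rfl⟩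
  have hXW : X = ρ • W := by rw [hW, smul_smul, mul_inv_cancel₀ hρ0, one_smul]
  have hW1 : g.inner p W W = 1 := by
    rw [hW, map_smul, map_smul, smul_apply, smul_eq_mul, smul_eq_mul, ← hρ2]
    field_simp
  rw [hXW, map_smul, hT.smul_left, hT.smul_two, hT.smul_three, hT.smul_four,
    holomorphic_comb_tensors hK ξ W hW1, hQF W hW1, hquad _ (by positivity)
    (eta_sq_add_le_one hK hξ.1 hW1)]
  ring

end QuasiConstant

/-! ### The algebraic inequality for totally symmetric cubic forms, with `m = n - 1` -/

section Inequality

variable {ι : Type*} [Fintype ι] [DecidableEq ι]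

/-- The case of the component of the second fundamental form in the direction `J X`. -/
theorem trace_form_le_self {m : ℝ} (hm : 2 ≤ m) (o : ι) (hcard : (Fintype.card ι : ℝ) = m + 1)
    (x : ι → ℝ) :
    1 / 2 * (∑ i, x i) ^ 2 - 1 / m * (x o * ∑ i, x i) + 1 / m * x o ^ 2 - 1 / 2 * x o ^ 2
      - (3 / 2 - 1 / m) * ∑ i ∈ Finset.univ.erase o, x i ^ 2
      ≤ (m - 1) * (3 * m + 2) / (2 * m * (3 * m + 8)) * (∑ i, x i) ^ 2 := by
  have h1 := Finset.add_sum_erase Finset.univ x (Finset.mem_univ o)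
  have h2 := sq_sum_le_card_mul_sum_sq (s := Finset.univ.erase o) (f := x)
  rw [Finset.card_erase_of_mem (Finset.mem_univ o), Finset.card_univ,
    Nat.cast_pred (Fintype.card_pos_iff.2 ⟨o⟩), hcard] at h2
  rw [← h1]
  set T := ∑ i ∈ Finset.univ.erase o, x i
  set Q := ∑ i ∈ Finset.univ.erase o, x i ^ 2
  set a := x o
  have hm0 : 0 < m := by linarith
  -- Cauchy–Schwarz over the `m` indices other than `o` reduces the claim to a binary form in `a`
  -- and `T`.
  have hQ : T ^ 2 / m ≤ Q := by
    rw [div_le_iff₀ hm0]; linarith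
  have hc : 0 ≤ 3 / 2 - 1 / m := by
    rw [sub_nonneg, div_le_iff₀ hm0]; linarith
  have h3 := mul_le_mul_of_nonneg_left hQ hc
  have key : 1 / 2 * (a + T) ^ 2 - 1 / m * (a * (a + T)) + 1 / m * a ^ 2 - 1 / 2 * a ^ 2
      - (3 / 2 - 1 / m) * (T ^ 2 / m)
      ≤ (m - 1) * (3 * m + 2) / (2 * m * (3 * m + 8)) * (a + T) ^ 2 := by
    rw [← sub_nonneg]
    have e : (m - 1) * (3 * m + 2) / (2 * m * (3 * m + 8)) * (a + T) ^ 2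
        - (1 / 2 * (a + T) ^ 2 - 1 / m * (a * (a + T)) + 1 / m * a ^ 2 - 1 / 2 * a ^ 2
          - (3 / 2 - 1 / m) * (T ^ 2 / m))
        = (m - 1) / m * ((3 * m + 2) / (2 * (3 * m + 8)) * (a - 6 / (3 * m + 2) * T) ^ 2
          + 2 / (m * (3 * m + 2)) * T ^ 2) := by
      have h8 : 3 * m + 8 ≠ 0 := by linarith
      have h9 : 3 * m + 2 ≠ 0 := by linarith
      field_simp
      ring
    have hr : 0 < m - 1 := by linarith
    rw [e]
    positivity
  linarith

/-- The case of a component of the second fundamental form orthogonal to `J X`. -/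
theorem trace_form_le_of_ne {m : ℝ} (hm : 2 ≤ m) {o k : ι} (hk : k ≠ o)
    (hcard : (Fintype.card ι : ℝ) = m + 1) (x : ι → ℝ) :
    1 / 2 * (∑ i, x i) ^ 2 - 1 / m * (x o * ∑ i, x i) - (3 / 2 - 2 / m) * x o ^ 2 - 1 / 2 * x k ^ 2
      - 3 / 2 * ∑ i ∈ (Finset.univ.erase o).erase k, x i ^ 2
      ≤ (m - 1) * (3 * m + 2) / (2 * m * (3 * m + 8)) * (∑ i, x i) ^ 2 := by
  have hk' : k ∈ Finset.univ.erase o := Finset.mem_erase.2 ⟨hk, Finset.mem_univ k⟩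
  have h1 := Finset.add_sum_erase Finset.univ x (Finset.mem_univ o)
  have h1' := Finset.add_sum_erase _ x hk'
  have h2 := sq_sum_le_card_mul_sum_sq (s := (Finset.univ.erase o).erase k) (f := x)
  rw [Finset.card_erase_of_mem hk', Nat.cast_pred (Finset.card_pos.2 ⟨k, hk'⟩),
    Finset.card_erase_of_mem (Finset.mem_univ o), Finset.card_univ,
    Nat.cast_pred (Fintype.card_pos_iff.2 ⟨o⟩), hcard] at h2
  rw [← h1, ← h1']
  set P := ∑ i ∈ (Finset.univ.erase o).erase k, x i
  set Q := ∑ i ∈ (Finset.univ.erase o).erase k, x i ^ 2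
  set a := x o
  set b := x k
  have hm0 : 0 < m := by linarith
  have hr : 0 < m - 1 := by linarith
  have hQ : P ^ 2 / (m - 1) ≤ Q := by
    rw [div_le_iff₀ hr]; linarith
  have key : 1 / 2 * (a + (b + P)) ^ 2 - 1 / m * (a * (a + (b + P))) - (3 / 2 - 2 / m) * a ^ 2
      - 1 / 2 * b ^ 2 - 3 / 2 * (P ^ 2 / (m - 1))
      ≤ (m - 1) * (3 * m + 2) / (2 * m * (3 * m + 8)) * (a + (b + P)) ^ 2 := by
    rw [← sub_nonneg]
    obtain ⟨S, hS⟩ : ∃ S, S = a + (b + P) := ⟨_, rfl⟩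
    -- For fixed trace `S` the left side is maximal at `a = 2S/(3m+8)`, `P = 3(m-1)S/(3m+8)`, `b =
    -- 9S/(3m+8)`, found with a Lagrange multiplier. The maximum is exactly the right side, which is
    -- the origin of the constant; `u` and `p` measure the deviation from this point.
    obtain ⟨u, hu⟩ : ∃ u, u = a - 2 * S / (3 * m + 8) := ⟨_, rfl⟩
    obtain ⟨p, hp⟩ : ∃ p, p = P - 3 * (m - 1) * S / (3 * m + 8) := ⟨_, rfl⟩
    have hb : b = S - a - P := by rw [hS]; ring
    have ha : a = u + 2 * S / (3 * m + 8) := by rw [hu]; ring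
    have hP : P = p + 3 * (m - 1) * S / (3 * m + 8) := by rw [hp]; ring
    have h8 : 0 < 3 * m + 8 := by linarith
    have e : (m - 1) * (3 * m + 2) / (2 * m * (3 * m + 8)) * (a + (b + P)) ^ 2
        - (1 / 2 * (a + (b + P)) ^ 2 - 1 / m * (a * (a + (b + P))) - (3 / 2 - 2 / m) * a ^ 2
          - 1 / 2 * b ^ 2 - 3 / 2 * (P ^ 2 / (m - 1)))
        = 2 * (m - 1) / m * u ^ 2 + u * p + (m + 2) / (2 * (m - 1)) * p ^ 2 := by
      rw [← hS, hb, ha, hP]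
      field_simp
      ring
    have e' : 2 * (m - 1) / m * u ^ 2 + u * p + (m + 2) / (2 * (m - 1)) * p ^ 2
        = 1 / (8 * m * (m - 1)) * ((4 * (m - 1) * u + m * p) ^ 2 + (3 * m ^ 2 + 8 * m) * p ^ 2) := by
      field_simp
      ring
    rw [e, e']
    positivity
  linarith

/-- Keep only the squares with `j = i`, `k = i` or `k = j`. By total symmetry the first two families
are both `h k i i`, the third is `h i k k`. The entry `i = j = k` is counted three times, hence the
correction `-2`. -/
theorem sum_sq_ge_of_symm (h : ι → ι → ι → ℝ) (h1 : ∀ k i j, h k i j = h k j i)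
    (h2 : ∀ k i j, h k i j = h j i k) (i : ι) :
    2 * ∑ k, h k i i ^ 2 + ∑ k, h i k k ^ 2 - 2 * h i i i ^ 2 ≤ ∑ j, ∑ k, h k i j ^ 2 := by
  have e : ∑ j, ∑ k, ((if i = j then h k i j ^ 2 else 0) + (if k = i then h k i j ^ 2 else 0)
      + (if k = j then h k i j ^ 2 else 0)
      - (if k = i then if i = j then 2 * h k i j ^ 2 else 0 else 0))
      = 2 * ∑ k, h k i i ^ 2 + ∑ k, h i k k ^ 2 - 2 * h i i i ^ 2 := by
    have e1 : ∀ j, h i i j = h j i i := fun j ↦ h2 i i j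
    have e2 : ∀ j, h j i j = h i j j := fun j ↦ by rw [h1, h2]
    simp only [Finset.sum_add_distrib, Finset.sum_sub_distrib]
    rw [Finset.sum_comm (f := fun j k ↦ if i = j then h k i j ^ 2 else 0)]
    simp only [Finset.sum_ite_eq, Finset.sum_ite_eq', Finset.mem_univ, if_true, e1, e2]
    ring
  rw [← e]
  refine Finset.sum_le_sum fun j _ ↦ Finset.sum_le_sum fun k _ ↦ ?_
  have := sq_nonneg (h k i j)
  by_cases a : i = j <;> by_cases b : k = i
  · subst a; subst b; simp; linarith
  · subst a; simp [b]
  · subst b; simp [a]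
  · by_cases c : k = j
    · simp [a, c, Ne.symm a]
    · simp [a, b, c, this]

/-- The contribution of the second fundamental form `h`, with components `h k i j`, to Oprea's
invariant of a Lagrangian submanifold. -/
theorem sum_trace_form_le {m : ℝ} (hm : 2 ≤ m) (o : ι) (hcard : (Fintype.card ι : ℝ) = m + 1)
    (h : ι → ι → ι → ℝ) (h1 : ∀ k i j, h k i j = h k j i) (h2 : ∀ k i j, h k i j = h j i k) :
    1 / 2 * ∑ i, ∑ j, ∑ k, (h k i i * h k j j - h k i j ^ 2)
      - 1 / m * ∑ j, ∑ k, (h k o o * h k j j - h k o j ^ 2)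
      ≤ (m - 1) * (3 * m + 2) / (2 * m * (3 * m + 8)) * ∑ k, (∑ i, h k i i) ^ 2 := by
  set C := (m - 1) * (3 * m + 2) / (2 * m * (3 * m + 8))
  have hm0 : 0 < m := by linarith
  -- These weights write `τ - Ric(e_o)/m` as one sum `∑ w_i Ric(e_i)`. They are nonnegative because
  -- `m ≥ 2`, so the lower bounds on the square sums may be added with weights.
  let w : ι → ℝ := fun i ↦ 1 / 2 - if i = o then 1 / m else 0
  have hwo : w o = 1 / 2 - 1 / m := by simp [w]
  have hwn : ∀ i, i ≠ o → w i = 1 / 2 := fun i hi ↦ by simp [w, hi]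
  have hws : ∀ F : ι → ℝ, ∑ i, w i * F i = 1 / 2 * ∑ i, F i - 1 / m * F o := fun F ↦ by
    simp [w, sub_mul, Finset.sum_sub_distrib, Finset.mul_sum]
  have hw : ∀ i, 0 ≤ w i := by
    intro i
    by_cases hi : i = o
    · rw [hi, hwo, sub_nonneg, div_le_div_iff₀ hm0 two_pos]; linarith
    · rw [hwn i hi]; norm_num
  have hB : ∑ k, (∑ i, (2 * w i + w k) * h k i i ^ 2 - 2 * w k * h k k k ^ 2)
      ≤ 1 / 2 * ∑ i, ∑ j, ∑ k, h k i j ^ 2 - 1 / m * ∑ j, ∑ k, h k o j ^ 2 := by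
    have e1 : 1 / 2 * ∑ i, ∑ j, ∑ k, h k i j ^ 2 - 1 / m * ∑ j, ∑ k, h k o j ^ 2
        = ∑ i, w i * ∑ j, ∑ k, h k i j ^ 2 := by
      rw [hws]
    have e2 : ∑ k, (∑ i, (2 * w i + w k) * h k i i ^ 2 - 2 * w k * h k k k ^ 2)
        = ∑ i, w i * (2 * ∑ k, h k i i ^ 2 + ∑ k, h i k k ^ 2 - 2 * h i i i ^ 2) := by
      simp only [mul_sub, mul_add, add_mul, Finset.sum_add_distrib, Finset.sum_sub_distrib,
        Finset.mul_sum]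
      congr 1
      · congr 1
        rw [Finset.sum_comm]
        exact Finset.sum_congr rfl fun i _ ↦ Finset.sum_congr rfl fun k _ ↦ by ring
      · exact Finset.sum_congr rfl fun i _ ↦ by ring
    rw [e1, e2]
    exact Finset.sum_le_sum fun i _ ↦
      mul_le_mul_of_nonneg_left (sum_sq_ge_of_symm h h1 h2 i) (hw i)
  have hk : ∀ k, 1 / 2 * (∑ i, h k i i) ^ 2 - 1 / m * (h k o o * ∑ i, h k i i)
      - (∑ i, (2 * w i + w k) * h k i i ^ 2 - 2 * w k * h k k k ^ 2)
      ≤ C * (∑ i, h k i i) ^ 2 := by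
    intro k
    have e0 : ∑ i, (2 * w i + w k) * h k i i ^ 2
        = 2 * (1 / 2 * ∑ i, h k i i ^ 2 - 1 / m * h k o o ^ 2) + w k * ∑ i, h k i i ^ 2 := by
      rw [← hws fun i ↦ h k i i ^ 2, Finset.mul_sum, Finset.mul_sum, ← Finset.sum_add_distrib]
      exact Finset.sum_congr rfl fun i _ ↦ by ring
    have es := Finset.add_sum_erase Finset.univ (fun i ↦ h k i i ^ 2) (Finset.mem_univ o)
    rw [e0, ← es]
    -- The coefficient of `(h k i i)²` is `2 w_i + w_k` for `i ≠ k` and `w_k` for `i = k`. For `k =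
    -- o` these are `3/2 - 1/m` and `1/2 - 1/m`. For `k ≠ o` they are `3/2 - 2/m` at `i = o`, `1/2`
    -- at `i = k`, and `3/2` otherwise.
    by_cases hko : k = o
    · subst hko
      rw [hwo]
      linarith [trace_form_le_self hm k hcard fun i ↦ h k i i]
    · have es' := Finset.add_sum_erase (Finset.univ.erase o) (fun i ↦ h k i i ^ 2)
        (Finset.mem_erase.2 ⟨hko, Finset.mem_univ k⟩)
      rw [hwn k hko, ← es']
      have e := trace_form_le_of_ne hm hko hcard fun i ↦ h k i i
      rw [show 2 / m = 2 * (1 / m) by ring] at e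
      linarith
  have e3 : ∑ i, ∑ j, ∑ k, h k i i * h k j j = ∑ k, (∑ i, h k i i) ^ 2 := by
    simp only [sq, Finset.sum_mul_sum]
    rw [Finset.sum_congr rfl fun i _ ↦ Finset.sum_comm, Finset.sum_comm]
  have e4 : ∑ j, ∑ k, h k o o * h k j j = ∑ k, h k o o * ∑ j, h k j j := by
    simp only [Finset.mul_sum]
    exact Finset.sum_comm
  have hsum := Finset.sum_le_sum fun k (_ : k ∈ Finset.univ) ↦ hk k
  simp only [Finset.sum_sub_distrib, ← Finset.mul_sum] at hsum hB ⊢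
  rw [e3, e4]
  linarith

end Inequality

/-! ### Orthonormal frames and traces -/

section Frames

variable {V : Type*} [AddCommGroup V] [Module ℝ V] {ι : Type*} [Fintype ι] [DecidableEq ι]

/-- `u` is an orthonormal basis for the scalar product `B`. -/
structure IsFrame (B : V →ₗ[ℝ] V →ₗ[ℝ] ℝ) (u : ι → V) : Prop where
  apply_eq : ∀ i j, B (u i) (u j) = if i = j then 1 else 0
  expand : ∀ x, x = ∑ i, B x (u i) • u i

theorem isFrame_of_card [Nonempty ι] {B : V →ₗ[ℝ] V →ₗ[ℝ] ℝ} {u : ι → V}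
    (hu : ∀ i j, B (u i) (u j) = if i = j then 1 else 0)
    (hc : Fintype.card ι = Module.finrank ℝ V) : IsFrame B u := by
  refine ⟨hu, fun x ↦ ?_⟩
  have key : ∀ (c : ι → ℝ) (j : ι), B (∑ i, c i • u i) (u j) = c j := by
    intro c j
    simp [map_sum, LinearMap.sum_apply, hu]
  have hli : LinearIndependent ℝ u := by
    rw [Fintype.linearIndependent_iff]
    intro c hc0 i
    rw [← key c i, hc0, map_zero, LinearMap.zero_apply]
  have hx : x ∈ Submodule.span ℝ (Set.range u) := by
    rw [hli.span_eq_top_of_card_eq_finrank hc]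
    trivial
  obtain ⟨c, rfl⟩ := (Submodule.mem_span_range_iff_exists_fun ℝ).1 hx
  simp only [key]

namespace IsFrame

variable {B : V →ₗ[ℝ] V →ₗ[ℝ] ℝ} {u : ι → V}

theorem parseval (hu : IsFrame B u) (x y : V) : B x y = ∑ i, B x (u i) * B (u i) y := by
  conv_lhs => rw [hu.expand x]
  simp [map_sum, LinearMap.sum_apply]

/-- The trace of a bilinear map does not depend on the orthonormal basis. -/
theorem trace_eq {κ : Type*} [Fintype κ] [DecidableEq κ] {X : Type*} [AddCommGroup X] [Module ℝ X]
    (hu : IsFrame B u) {v : κ → V} (hv : IsFrame B v) (F : V →ₗ[ℝ] V →ₗ[ℝ] X)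
    (hB : ∀ x y, B x y = B y x) : ∑ i, F (v i) (v i) = ∑ i, F (u i) (u i) := by
  have e : ∀ i, F (v i) (v i)
      = ∑ j, ∑ k, (B (u j) (v i) * B (v i) (u k)) • F (u j) (u k) := by
    intro i
    conv_lhs => rw [hu.expand (v i)]
    simp only [map_sum, LinearMap.sum_apply, map_smul, LinearMap.smul_apply, Finset.smul_sum, smul_smul]
    rw [Finset.sum_comm]
    refine Finset.sum_congr rfl fun j _ ↦ Finset.sum_congr rfl fun k _ ↦ ?_
    rw [hB (u j), mul_comm]
  calc ∑ i, F (v i) (v i)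
      = ∑ j, ∑ k, (∑ i, B (u j) (v i) * B (v i) (u k)) • F (u j) (u k) := by
        simp only [e, Finset.sum_smul]
        rw [Finset.sum_comm]
        exact Finset.sum_congr rfl fun j _ ↦ Finset.sum_comm
    _ = ∑ i, F (u i) (u i) := by
        simp only [← hv.parseval, hu.apply_eq, ite_smul, one_smul, zero_smul, Finset.sum_ite_eq,
          Finset.mem_univ, if_true]

theorem sum_smul_apply (hu : IsFrame B u) (x y : ι → ℝ) :
    B (∑ i, x i • u i) (∑ i, y i • u i) = ∑ i, x i * y i := by
  simp [map_sum, LinearMap.sum_apply, hu.apply_eq, mul_comm]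

/-- In the coordinates of `u` the unit vector `x` lies in a Euclidean space, where it extends to an
orthonormal basis; that basis is carried back. -/
theorem exists_frame_apply_eq (hu : IsFrame B u) (hc : Fintype.card ι = Module.finrank ℝ V)
    (o : ι) {x : V} (hx : B x x = 1) (hB : ∀ x y, B x y = B y x) :
    ∃ v : ι → V, IsFrame B v ∧ v o = x := by
  have : Nonempty ι := ⟨o⟩
  let y : EuclideanSpace ℝ ι := WithLp.toLp 2 fun i ↦ B x (u i)
  have hy : ‖y‖ = 1 := by
    rw [EuclideanSpace.norm_eq, Real.sqrt_eq_one]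
    have e : ∑ i, B x (u i) * B (u i) x = 1 := by rw [← hu.parseval, hx]
    rw [← e]
    exact Finset.sum_congr rfl fun i _ ↦ by rw [hB (u i), Real.norm_eq_abs, sq_abs, sq]
  have ho : Orthonormal ℝ (({o} : Set ι).domRestrict fun _ ↦ y) :=
    ⟨fun _ ↦ hy, fun i j hij ↦ (hij (Subsingleton.elim i j)).elim⟩
  obtain ⟨b, hb⟩ := ho.exists_orthonormalBasis_extension_of_card_eq
    (by rw [finrank_euclideanSpace])
  refine ⟨fun i ↦ ∑ j, b i j • u j, isFrame_of_card (fun i j ↦ ?_) hc, ?_⟩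
  · rw [hu.sum_smul_apply, ← orthonormal_iff_ite.1 b.orthonormal i j, PiLp.inner_apply]
    exact Finset.sum_congr rfl fun k _ ↦ by simp [mul_comm]
  · simp only [hb o rfl]
    exact (hu.expand x).symm

/-- Compactness of the unit sphere, in coordinates. This is why the minimum of the Ricci curvature
is attained. -/
theorem exists_forall_le (hu : IsFrame B u) [Nonempty ι] (F : V →ₗ[ℝ] V →ₗ[ℝ] ℝ) :
    ∃ x, B x x = 1 ∧ ∀ y, B y y = 1 → F x x ≤ F y y := by
  let s : EuclideanSpace ℝ ι → V := fun x ↦ ∑ i, x i • u i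
  have hcont : Continuous fun x : EuclideanSpace ℝ ι ↦ F (s x) (s x) := by
    simp only [s, map_sum, LinearMap.sum_apply, map_smul, LinearMap.smul_apply, smul_eq_mul]
    fun_prop
  have hne : (Metric.sphere (0 : EuclideanSpace ℝ ι) 1).Nonempty :=
    ⟨EuclideanSpace.single (Classical.arbitrary ι) 1, by simp⟩
  obtain ⟨x, hx, hmin⟩ := (isCompact_sphere (0 : EuclideanSpace ℝ ι) 1).exists_isMinOn hne
    hcont.continuousOn
  have hnorm : ∀ x : EuclideanSpace ℝ ι, B (s x) (s x) = ‖x‖ ^ 2 := by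
    intro x
    rw [hu.sum_smul_apply, EuclideanSpace.norm_sq_eq]
    exact Finset.sum_congr rfl fun i _ ↦ by rw [Real.norm_eq_abs, sq_abs, sq]
  refine ⟨s x, by rw [hnorm, mem_sphere_zero_iff_norm.1 hx, one_pow], fun y hy ↦ ?_⟩
  let z : EuclideanSpace ℝ ι := WithLp.toLp 2 fun i ↦ B y (u i)
  have hz : s z = y := (hu.expand y).symm
  have hz1 : z ∈ Metric.sphere (0 : EuclideanSpace ℝ ι) 1 := by
    rw [mem_sphere_zero_iff_norm, ← sq_eq_sq₀ (norm_nonneg _) zero_le_one, ← hnorm, hz, hy, one_pow]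
  have hle : F (s x) (s x) ≤ F (s z) (s z) := hmin hz1
  rwa [hz] at hle

end IsFrame

end Frames

/-! ### The inequality on a single tangent space -/

section Pointwise

variable {V W : Type*} [AddCommGroup V] [Module ℝ V] [AddCommGroup W] [Module ℝ W]

/-- The inclusion `L` of a tangent space of a Lagrangian submanifold of a Kähler manifold and its
second fundamental form `h`. -/
structure IsLagrangianSff (g : W →ₗ[ℝ] W →ₗ[ℝ] ℝ) (J : W →ₗ[ℝ] W) (L : V →ₗ[ℝ] W)
    (h : V →ₗ[ℝ] V →ₗ[ℝ] W) : Prop where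
  symm : ∀ x y, g x y = g y x
  orthogonal : ∀ x y, g (J x) (J y) = g x y
  skew : ∀ x y, g x (J y) = -g (J x) y
  normal : ∀ v w, g (J (L v)) (L w) = 0
  sff_symm : ∀ v w, h v w = h w v
  sff_normal : ∀ v w z, g (h v w) (L z) = 0
  sff_cubic : ∀ u v w, g (h u v) (J (L w)) = g (h u w) (J (L v))

/-- The Gauss equation gives `R(u, v, w, u)` of a Lagrangian submanifold in terms of the second
fundamental form `h`, the functions `a`, `b`, `c` and the 1-forms `α = η^⊤`, `β = η̃^⊤`. -/
noncomputable def gaussForm (g : W →ₗ[ℝ] W →ₗ[ℝ] ℝ) (L : V →ₗ[ℝ] W) (h : V →ₗ[ℝ] V →ₗ[ℝ] W)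
    (a b c : ℝ) (α β : V →ₗ[ℝ] ℝ) (u : V) : V →ₗ[ℝ] V →ₗ[ℝ] ℝ :=
  LinearMap.mk₂ ℝ (fun v w ↦
    a / 4 * (g (L v) (L w) * g (L u) (L u) - g (L u) (L v) * g (L u) (L w))
    + b / 8 * (g (L v) (L w) * (α u * α u + β u * β u) - g (L u) (L v) * (α u * α w + β u * β w)
      - g (L u) (L w) * (α u * α v + β u * β v) + g (L u) (L u) * (α v * α w + β v * β w))
    + c * ((α u * β v - α v * β u) * (α u * β w - α w * β u))
    + (g (h v w) (h u u) - g (h u v) (h u w)))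
    (fun _ _ _ ↦ by simp only [map_add, LinearMap.add_apply]; ring)
    (fun _ _ _ ↦ by simp only [map_smul, LinearMap.smul_apply, smul_eq_mul]; ring)
    (fun _ _ _ ↦ by simp only [map_add, LinearMap.add_apply]; ring)
    (fun _ _ _ ↦ by simp only [map_smul, LinearMap.smul_apply, smul_eq_mul]; ring)

theorem gaussForm_self (g : W →ₗ[ℝ] W →ₗ[ℝ] ℝ) (L : V →ₗ[ℝ] W) (h : V →ₗ[ℝ] V →ₗ[ℝ] W)
    (a b c : ℝ) (α β : V →ₗ[ℝ] ℝ) (u : V) :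
    gaussForm g L h a b c α β u u u = 0 := by
  simp only [gaussForm, LinearMap.mk₂_apply]
  ring

namespace IsLagrangianSff

variable {g : W →ₗ[ℝ] W →ₗ[ℝ] ℝ} {J : W →ₗ[ℝ] W} {L : V →ₗ[ℝ] W} {h : V →ₗ[ℝ] V →ₗ[ℝ] W}
  {ι : Type*} [Fintype ι] [DecidableEq ι]

theorem gaussForm_symm (H : IsLagrangianSff g J L h) (a b c : ℝ) (α β : V →ₗ[ℝ] ℝ) (u v : V) :
    gaussForm g L h a b c α β u v v = gaussForm g L h a b c α β v u u := by
  simp only [gaussForm, LinearMap.mk₂_apply, H.symm (L v) (L u), H.sff_symm v u,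
    H.symm (h v v) (h u u)]
  ring

/-- The Lagrangian dimension count: the vectors `L e_i` and `J L e_i` are orthonormal, and there are
`dim W` of them. -/
theorem isFrame_adapted (H : IsLagrangianSff g J L h) [Nonempty ι] {e : ι → V}
    (he : ∀ i j, g (L (e i)) (L (e j)) = if i = j then 1 else 0)
    (hc : 2 * Fintype.card ι = Module.finrank ℝ W) :
    IsFrame g (Sum.elim (fun i ↦ L (e i)) fun i ↦ J (L (e i))) := by
  refine isFrame_of_card ?_ (by rw [Fintype.card_sum, ← hc, two_mul])
  rintro (i | i) (j | j)
  · simp [he]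
  · simp [H.symm (L (e i)), H.normal]
  · simp [H.normal]
  · simp [H.orthogonal, he]

theorem parseval_normal (H : IsLagrangianSff g J L h) [Nonempty ι] {e : ι → V}
    (he : ∀ i j, g (L (e i)) (L (e j)) = if i = j then 1 else 0)
    (hc : 2 * Fintype.card ι = Module.finrank ℝ W) {x : W} (hx : ∀ v, g x (L v) = 0) (y : W) :
    g x y = ∑ k, g x (J (L (e k))) * g y (J (L (e k))) := by
  rw [(H.isFrame_adapted he hc).parseval x y, Fintype.sum_sum_type]
  simp [hx, H.symm y]

/-- The components of `ξ` along `J L e_i` are, up to sign, those of `Jξ` along `L e_i`. So `‖ξ‖² =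
1` says `‖η^⊤‖² + ‖η̃^⊤‖² = 1`. -/
theorem sum_sq_eq_one (H : IsLagrangianSff g J L h) [Nonempty ι] {e : ι → V}
    (he : ∀ i j, g (L (e i)) (L (e j)) = if i = j then 1 else 0)
    (hc : 2 * Fintype.card ι = Module.finrank ℝ W) {ξ : W} (hξ : g ξ ξ = 1) :
    ∑ i, g ξ (L (e i)) ^ 2 + ∑ i, g (J ξ) (L (e i)) ^ 2 = 1 := by
  have := (H.isFrame_adapted he hc).parseval ξ ξ
  rw [hξ, Fintype.sum_sum_type] at this
  rw [this]
  congr 1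
  · exact Finset.sum_congr rfl fun i _ ↦ by simp [H.symm ξ (L (e i)), sq]
  · exact Finset.sum_congr rfl fun i _ ↦ by
      simp only [Sum.elim_inr]
      rw [H.symm (J (L (e i))), H.skew, sq, neg_mul_neg]

/-- The Oprea inequality in an orthonormal basis whose element `e o` is the given unit vector. -/
theorem oprea_le (H : IsLagrangianSff g J L h) {e : ι → V}
    (he : ∀ i j, g (L (e i)) (L (e j)) = if i = j then 1 else 0)
    (hc : 2 * Fintype.card ι = Module.finrank ℝ W) {n : ℝ} (hn : 3 ≤ n)
    (hcard : (Fintype.card ι : ℝ) = n) (o : ι) {ξ : W} (hξ : g ξ ξ = 1)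
    (a b c : ℝ) {α β : V →ₗ[ℝ] ℝ} (hα : ∀ v, α v = g ξ (L v)) (hβ : ∀ v, β v = g (J ξ) (L v)) :
    1 / 2 * ∑ i, ∑ j, gaussForm g L h a b c α β (e i) (e j) (e j)
      - 1 / (n - 1) * ∑ j, gaussForm g L h a b c α β (e o) (e j) (e j)
    ≤ (n - 2) * (n + 1) / 8 * a
      + (n - 2) / (8 * (n - 1)) * (n - (α (e o) ^ 2 + β (e o) ^ 2)) * b
      + ((∑ i, α (e i) * α (e i)) * (∑ i, β (e i) * β (e i)) - (∑ i, α (e i) * β (e i)) ^ 2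
        - 1 / (n - 1) * ∑ j, (α (e o) * β (e j) - β (e o) * α (e j))
            * (α (e o) * β (e j) - β (e o) * α (e j))) * c
      + (3 * n - 1) * (n - 2) / (2 * (n - 1) * (3 * n + 5))
        * g (∑ i, h (e i) (e i)) (∑ i, h (e i) (e i)) := by
  have : Nonempty ι := ⟨o⟩
  have hs : ∑ i, α (e i) * α (e i) + ∑ i, β (e i) * β (e i) = 1 := by
    rw [← H.sum_sq_eq_one he hc hξ]
    simp only [hα, hβ, sq]
  let q : ι → ι → ι → ℝ := fun k i j ↦ g (h (e i) (e j)) (J (L (e k)))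
  have hq1 : ∀ k i j, q k i j = q k j i := fun k i j ↦ by simp only [q, H.sff_symm (e i)]
  have hq2 : ∀ k i j, q k i j = q j i k := fun k i j ↦ H.sff_cubic _ _ _
  have hhh : ∀ i j i' j', g (h (e i) (e j)) (h (e i') (e j')) = ∑ k, q k i j * q k i' j' :=
    fun i j i' j' ↦ H.parseval_normal he hc (H.sff_normal _ _) _
  have hH : g (∑ i, h (e i) (e i)) (∑ i, h (e i) (e i)) = ∑ k, (∑ i, q k i i) ^ 2 := by
    rw [H.parseval_normal he hc fun v ↦ by
      rw [map_sum, LinearMap.sum_apply]; exact Finset.sum_eq_zero fun i _ ↦ H.sff_normal _ _ _]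
    exact Finset.sum_congr rfl fun k _ ↦ by simp only [map_sum, LinearMap.sum_apply, sq, q]
  -- The correction terms at `i = j` make the formula valid on the diagonal, where the form
  -- vanishes, so sums may run over all indices.
  have hform : ∀ i j, gaussForm g L h a b c α β (e i) (e j) (e j)
      = a / 4 * (1 - if i = j then 1 else 0)
        + b / 8 * ((α (e i) * α (e i) + β (e i) * β (e i)) + (α (e j) * α (e j) + β (e j) * β (e j))
          - 2 * (if i = j then α (e i) * α (e j) + β (e i) * β (e j) else 0))
        + c * ((α (e i) * β (e j) - β (e i) * α (e j)) * (α (e i) * β (e j) - β (e i) * α (e j)))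
        + ∑ k, (q k i i * q k j j - q k i j ^ 2) := by
    intro i j
    simp only [gaussForm, LinearMap.mk₂_apply, he, hhh, Finset.sum_sub_distrib]
    have e1 : ∑ k, q k j j * q k i i = ∑ k, q k i i * q k j j :=
      Finset.sum_congr rfl fun k _ ↦ mul_comm _ _
    have e2 : ∑ k, q k i j * q k i j = ∑ k, q k i j ^ 2 :=
      Finset.sum_congr rfl fun k _ ↦ (sq _).symm
    rw [e1, e2]
    rcases eq_or_ne i j with rfl | hij
    · simp only [if_true]
      ring
    · simp only [hij, if_true, if_false]
      ring
  have key := sum_trace_form_le (m := n - 1) (by linarith) o (by rw [hcard]; ring) q hq1 hq2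
  rw [← hH, show n - 1 - 1 = n - 2 by ring, show 3 * (n - 1) + 2 = 3 * n - 1 by ring,
    show 3 * (n - 1) + 8 = 3 * n + 5 by ring] at key
  set SA := ∑ i, α (e i) * α (e i) with hSA
  set SB := ∑ i, β (e i) * β (e i) with hSB
  set SC := ∑ i, α (e i) * β (e i) with hSC
  have hrow : ∀ i, ∑ j, gaussForm g L h a b c α β (e i) (e j) (e j)
      = a / 4 * (n - 1) + b / 8 * ((n - 2) * (α (e i) * α (e i) + β (e i) * β (e i)) + 1)
        + c * ∑ j, (α (e i) * β (e j) - β (e i) * α (e j)) * (α (e i) * β (e j) - β (e i) * α (e j))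
        + ∑ j, ∑ k, (q k i i * q k j j - q k i j ^ 2) := by
    intro i
    simp only [hform, Finset.sum_add_distrib, ← Finset.mul_sum, Finset.sum_sub_distrib,
      Finset.sum_const, Finset.card_univ, nsmul_eq_mul, hcard, Finset.sum_ite_eq,
      Finset.mem_univ, if_true]
    rw [← hSA, ← hSB]
    linear_combination b / 8 * hs
  -- Lagrange's identity for the two 1-forms.
  have hω : ∑ i, ∑ j, (α (e i) * β (e j) - β (e i) * α (e j))
      * (α (e i) * β (e j) - β (e i) * α (e j)) = 2 * (SA * SB - SC ^ 2) := by
    have e1 : ∀ i j, (α (e i) * β (e j) - β (e i) * α (e j))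
        * (α (e i) * β (e j) - β (e i) * α (e j))
        = (α (e i) * α (e i)) * (β (e j) * β (e j)) + (β (e i) * β (e i)) * (α (e j) * α (e j))
          - 2 * ((α (e i) * β (e i)) * (α (e j) * β (e j))) := fun i j ↦ by ring
    simp only [e1, Finset.sum_add_distrib, Finset.sum_sub_distrib, ← Finset.mul_sum,
      ← Finset.sum_mul]
    rw [← hSA, ← hSB, ← hSC]
    ring
  have htot : ∑ i, ∑ j, gaussForm g L h a b c α β (e i) (e j) (e j)
      = a / 4 * (n * (n - 1)) + b / 8 * ((n - 2) + n) + c * (2 * (SA * SB - SC ^ 2))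
        + ∑ i, ∑ j, ∑ k, (q k i i * q k j j - q k i j ^ 2) := by
    simp only [hrow, Finset.sum_add_distrib, ← Finset.mul_sum, hω, Finset.sum_const,
      Finset.card_univ, nsmul_eq_mul, hcard]
    rw [← hSA, ← hSB]
    linear_combination b / 8 * (n - 2) * hs
  rw [htot, hrow]
  have hn1 : n - 1 ≠ 0 := by linarith
  have ea : 1 / 2 * (a / 4 * (n * (n - 1))) - 1 / (n - 1) * (a / 4 * (n - 1))
      = (n - 2) * (n + 1) / 8 * a := by
    field_simp
    ring
  have eb : 1 / 2 * (b / 8 * ((n - 2) + n))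
      - 1 / (n - 1) * (b / 8 * ((n - 2) * (α (e o) * α (e o) + β (e o) * β (e o)) + 1))
      = (n - 2) / (8 * (n - 1)) * (n - (α (e o) ^ 2 + β (e o) ^ 2)) * b := by
    field_simp
    ring
  have ec : (n - 2) * (3 * n - 1) = (3 * n - 1) * (n - 2) := mul_comm _ _
  rw [ec] at key
  linarith

end IsLagrangianSff

end Pointwise

/-! ### The pointwise data of a Lagrangian immersion -/

section Immersion

variable {E : Type*} [NormedAddCommGroup E] [NormedSpace ℝ E]
  {M : Type*} [TopologicalSpace M] [ChartedSpace E M] [IsManifold 𝓘(ℝ, E) ∞ M]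
  {E' : Type*} [NormedAddCommGroup E'] [NormedSpace ℝ E']
  {N : Type*} [TopologicalSpace N] [ChartedSpace E' N] [IsManifold 𝓘(ℝ, E') ∞ N]
  {f : N → M}
  {g : Bundle.ContMDiffRiemannianMetric 𝓘(ℝ, E) ∞ E (fun x : M ↦ TangentSpace 𝓘(ℝ, E) x)}
  {J : ∀ x : M, TangentSpace 𝓘(ℝ, E) x →L[ℝ] TangentSpace 𝓘(ℝ, E) x}

theorem secondFundamentalForm_eq_coordSff (q : N) (X Y : TangentSpace 𝓘(ℝ, E') q) :
    secondFundamentalForm g.inner f q X Y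
      = coordSff (coordMetric (inducedMetric g.inner f) q) (coordMetric g.inner (f q))
        (writtenInExtChartAt 𝓘(ℝ, E') 𝓘(ℝ, E) q f) (extChartAt 𝓘(ℝ, E') q q) X Y := by
  have key : ∀ x y : E', coordSff (coordMetric (inducedMetric g.inner f) q)
      (coordMetric g.inner (f q)) (writtenInExtChartAt 𝓘(ℝ, E') 𝓘(ℝ, E) q f)
      (extChartAt 𝓘(ℝ, E') q q) x y = _ := fun x y ↦ by
    rw [coordSff, christoffelMap_apply, christoffelMap_apply]
  have hinv (w : E) : (ContinuousLinearMap.id ℝ E).inverse w = w := by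
    rw [ContinuousLinearMap.inverse_id, ContinuousLinearMap.id_apply]
  unfold secondFundamentalForm
  simp only [dChart_self]
  exact (hinv _).trans (key X Y).symm

/-- The second fundamental form as a bilinear map. -/
noncomputable def sffMap (g : Bundle.ContMDiffRiemannianMetric 𝓘(ℝ, E) ∞ E
      (fun x : M ↦ TangentSpace 𝓘(ℝ, E) x)) (f : N → M) (q : N) :
    TangentSpace 𝓘(ℝ, E') q →ₗ[ℝ] TangentSpace 𝓘(ℝ, E') q →ₗ[ℝ] TangentSpace 𝓘(ℝ, E) (f q) :=
  let h : E' →ₗ[ℝ] E' →ₗ[ℝ] E := LinearMap.mk₂ ℝ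
    (coordSff (coordMetric (inducedMetric g.inner f) q) (coordMetric g.inner (f q))
      (writtenInExtChartAt 𝓘(ℝ, E') 𝓘(ℝ, E) q f) (extChartAt 𝓘(ℝ, E') q q))
    (fun _ _ _ ↦ by simp only [coordSff, map_add, add_apply]; abel)
    (fun _ _ _ ↦ by simp only [coordSff, map_smul, smul_apply]; module)
    (fun _ _ _ ↦ by simp only [coordSff, map_add]; abel)
    (fun _ _ _ ↦ by simp only [coordSff, map_smul]; module)
  h

theorem sffMap_apply (q : N) (X Y : TangentSpace 𝓘(ℝ, E') q) :
    sffMap g f q X Y = secondFundamentalForm g.inner f q X Y :=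
  (secondFundamentalForm_eq_coordSff q X Y).symm

omit [IsManifold 𝓘(ℝ, E') ∞ N] in
theorem coordMetric_written_self
    (g : ∀ x : M, TangentSpace 𝓘(ℝ, E) x →L[ℝ] TangentSpace 𝓘(ℝ, E) x →L[ℝ] ℝ) (f : N → M) (q : N) :
    coordMetric g (f q) (writtenInExtChartAt 𝓘(ℝ, E') 𝓘(ℝ, E) q f (extChartAt 𝓘(ℝ, E') q q))
      = g (f q) := by
  rw [writtenInExtChartAt_self]
  exact ContinuousLinearMap.ext fun v ↦ ContinuousLinearMap.ext fun w ↦ coordMetric_self g (f q) v w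

omit [IsManifold 𝓘(ℝ, E') ∞ N] in
theorem coordEndo_written_self
    (J : ∀ x : M, TangentSpace 𝓘(ℝ, E) x →L[ℝ] TangentSpace 𝓘(ℝ, E) x) (f : N → M) (q : N) :
    coordEndo J (f q) (writtenInExtChartAt 𝓘(ℝ, E') 𝓘(ℝ, E) q f (extChartAt 𝓘(ℝ, E') q q))
      = J (f q) := by
  rw [writtenInExtChartAt_self]
  exact ContinuousLinearMap.ext fun v ↦ coordEndo_self J (f q) v

variable [FiniteDimensional ℝ E] [FiniteDimensional ℝ E']

theorem IsLagrangianImmersion.isLagrangianSff (hK : IsKaehler g J)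
    (h : IsLagrangianImmersion (E' := E') g.inner J f) (q : N) :
    IsLagrangianSff (g.inner (f q)).toLinearMap₁₂ (J (f q)).toLinearMap
      (mfderiv 𝓘(ℝ, E') 𝓘(ℝ, E) f q).toLinearMap (sffMap g f q) := by
  have hiso := h.isometryAt q
  have hL := mfderiv_eq_fderiv_writtenInExtChartAt (f := f) (q := q)
    ((h.smooth q).mdifferentiableAt (by simp))
  refine ⟨fun x y ↦ g.symm _ _ _, fun x y ↦ hK.orthogonal _ _ _, fun x y ↦ hK.skew _ _,
    fun v w ↦ h.normal q v w, fun v w ↦ hiso.coordSff_symm v w, fun v w z ↦ ?_, fun u v w ↦ ?_⟩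
  · have e := hiso.apply_coordSff v w z
    rw [← hL, coordMetric_written_self] at e
    exact e
  · have hJ : ParallelAt (coordMetric g.inner (f q)) (coordEndo J (f q))
        (writtenInExtChartAt 𝓘(ℝ, E') 𝓘(ℝ, E) q f (extChartAt 𝓘(ℝ, E') q q)) := by
      rw [writtenInExtChartAt_self]; exact hK.parallelAt (f q)
    have e := hiso.lagrangian_coordSff_symm hJ (fun v w ↦ by
      rw [coordEndo_written_self, coordMetric_written_self]
      exact neg_eq_iff_eq_neg.1 (hK.skew (p := f q) v w).symm) (h.eventually_normal q) u v w
    rw [← hL, coordEndo_written_self, coordMetric_written_self] at e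
    exact e

theorem IsLagrangianImmersion.riemann_eq (h : IsLagrangianImmersion (E' := E') g.inner J f) (q : N)
    (u v w z : TangentSpace 𝓘(ℝ, E') q) :
    riemann (inducedMetric g.inner f) q u v w z
      = riemann g.inner (f q) (mfderiv 𝓘(ℝ, E') 𝓘(ℝ, E) f q u)
          (mfderiv 𝓘(ℝ, E') 𝓘(ℝ, E) f q v) (mfderiv 𝓘(ℝ, E') 𝓘(ℝ, E) f q w)
          (mfderiv 𝓘(ℝ, E') 𝓘(ℝ, E) f q z)
        + g.inner (f q) (sffMap g f q v w) (sffMap g f q u z)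
        - g.inner (f q) (sffMap g f q u w) (sffMap g f q v z) := by
  have hL := mfderiv_eq_fderiv_writtenInExtChartAt (f := f) (q := q)
    ((h.smooth q).mdifferentiableAt (by simp))
  have e := (h.isometryAt q).gauss u v w z
  rw [← hL, coordMetric_written_self, writtenInExtChartAt_self] at e
  rw [QCH.riemann_eq, QCH.riemann_eq, ← writtenInExtChartAt_self (E' := E') f q, coordMetric_written_self,
    writtenInExtChartAt_self]
  exact e

/-- On tangent vectors every factor `g(J ·, ·)` in `π` and `Φ` vanishes. What remains of the ambient
curvature, plus the Gauss terms, is `gaussForm`. -/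
theorem IsLagrangianImmersion.riemann_eq_gaussForm {D : ∀ x : M, Submodule ℝ (TangentSpace 𝓘(ℝ, E) x)}
    {a b c : M → ℝ} (hR : HasCurvatureFunctions g J D a b c)
    (h : IsLagrangianImmersion (E' := E') g.inner J f) (q : N)
    {ξ : TangentSpace 𝓘(ℝ, E) (f q)} (hξ : IsUnitNormal g D (f q) ξ)
    (u v w : TangentSpace 𝓘(ℝ, E') q) :
    riemann (inducedMetric g.inner f) q u v w u
      = gaussForm (g.inner (f q)).toLinearMap₁₂ (mfderiv 𝓘(ℝ, E') 𝓘(ℝ, E) f q).toLinearMap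
        (sffMap g f q) (a (f q)) (b (f q)) (c (f q))
        (((g.inner (f q) ξ).comp (mfderiv 𝓘(ℝ, E') 𝓘(ℝ, E) f q)).toLinearMap)
        (((g.inner (f q) (J (f q) ξ)).comp (mfderiv 𝓘(ℝ, E') 𝓘(ℝ, E) f q)).toLinearMap) u v w := by
  rw [h.riemann_eq, hR (f q) ξ hξ]
  simp only [piTensor, phiTensor, psiTensor, eta, h.normal, gaussForm, LinearMap.mk₂_apply,
    ContinuousLinearMap.toLinearMap₁₂_apply_apply_apply, ContinuousLinearMap.coe_coe,
    ContinuousLinearMap.comp_apply]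
  rw [g.symm (f q) (mfderiv 𝓘(ℝ, E') 𝓘(ℝ, E) f q v) (mfderiv 𝓘(ℝ, E') 𝓘(ℝ, E) f q u),
    g.symm (f q) (sffMap g f q u w) (sffMap g f q v u),
    show sffMap g f q v u = sffMap g f q u v from (h.isometryAt q).coordSff_symm v u]
  ring

end Immersion

/-! ### Independence of the frame, and Oprea's invariant -/

theorem sum_lt_eq_half_sum {n : ℕ} (K : Fin n → Fin n → ℝ) (hs : ∀ i j, K i j = K j i)
    (h0 : ∀ i, K i i = 0) : (∑ i, ∑ j, if i < j then K i j else 0) = 1 / 2 * ∑ i, ∑ j, K i j := by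
  have e1 : ∑ i, ∑ j, K i j
      = (∑ i, ∑ j, if i < j then K i j else 0) + ∑ i, ∑ j, if j < i then K i j else 0 := by
    simp only [← Finset.sum_add_distrib]
    refine Finset.sum_congr rfl fun i _ ↦ Finset.sum_congr rfl fun j _ ↦ ?_
    rcases lt_trichotomy i j with hij | rfl | hij
    · simp [hij, hij.not_gt]
    · simp [h0]
    · simp [hij, hij.not_gt]
  have e2 : (∑ i, ∑ j, if j < i then K i j else 0) = ∑ i, ∑ j, if i < j then K i j else 0 := by
    rw [Finset.sum_comm]
    simp only [hs]
  rw [e1, e2]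
  ring

namespace IsLagrangianSff

variable {V W : Type*} [AddCommGroup V] [Module ℝ V] [AddCommGroup W] [Module ℝ W]
  {g : W →ₗ[ℝ] W →ₗ[ℝ] ℝ} {J : W →ₗ[ℝ] W} {L : V →ₗ[ℝ] W} {h : V →ₗ[ℝ] V →ₗ[ℝ] W}
  {ι : Type*} [Fintype ι] [DecidableEq ι] {B : V →ₗ[ℝ] V →ₗ[ℝ] ℝ} {u v : ι → V}

/-- `gaussForm` is bilinear only in its last two arguments. The frame is changed there first; pair
symmetry then moves the other index into that position. -/
theorem sum_gaussForm_eq (H : IsLagrangianSff g J L h) (hu : IsFrame B u) (hv : IsFrame B v)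
    (hB : ∀ x y, B x y = B y x) (a b c : ℝ) (α β : V →ₗ[ℝ] ℝ) :
    ∑ i, ∑ j, gaussForm g L h a b c α β (v i) (v j) (v j)
      = ∑ i, ∑ j, gaussForm g L h a b c α β (u i) (u j) (u j) := by
  calc _ = ∑ i, ∑ j, gaussForm g L h a b c α β (v i) (u j) (u j) :=
        Finset.sum_congr rfl fun i _ ↦ hu.trace_eq hv _ hB
    _ = ∑ j, ∑ i, gaussForm g L h a b c α β (u j) (v i) (v i) := by
        rw [Finset.sum_comm]
        exact Finset.sum_congr rfl fun j _ ↦ Finset.sum_congr rfl fun i _ ↦ H.gaussForm_symm ..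
    _ = _ := Finset.sum_congr rfl fun i _ ↦ hu.trace_eq hv _ hB

/-- Every sum in the inequality is a trace, so it can be evaluated in a frame containing `x`, where
`oprea_le` applies, and transferred to `u`. -/
theorem oprea_le_of_unit (H : IsLagrangianSff g J L h) (hBg : ∀ x y, B x y = g (L x) (L y))
    (hu : IsFrame B u) (hcV : Fintype.card ι = Module.finrank ℝ V)
    (hc : 2 * Fintype.card ι = Module.finrank ℝ W) {n : ℝ} (hn : 3 ≤ n)
    (hcard : (Fintype.card ι : ℝ) = n) {x : V} (hx : B x x = 1) {ξ : W} (hξ : g ξ ξ = 1)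
    (a b c : ℝ) {α β : V →ₗ[ℝ] ℝ} (hα : ∀ v, α v = g ξ (L v)) (hβ : ∀ v, β v = g (J ξ) (L v)) :
    1 / 2 * ∑ i, ∑ j, gaussForm g L h a b c α β (u i) (u j) (u j)
      - 1 / (n - 1) * ∑ j, gaussForm g L h a b c α β x (u j) (u j)
    ≤ (n - 2) * (n + 1) / 8 * a
      + (n - 2) / (8 * (n - 1)) * (n - (α x ^ 2 + β x ^ 2)) * b
      + ((∑ i, α (u i) * α (u i)) * (∑ i, β (u i) * β (u i)) - (∑ i, α (u i) * β (u i)) ^ 2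
        - 1 / (n - 1) * ∑ j, (α x * β (u j) - β x * α (u j))
            * (α x * β (u j) - β x * α (u j))) * c
      + (3 * n - 1) * (n - 2) / (2 * (n - 1) * (3 * n + 5))
        * g (∑ i, h (u i) (u i)) (∑ i, h (u i) (u i)) := by
  have hB : ∀ x y, B x y = B y x := fun x y ↦ by rw [hBg, hBg, H.symm]
  have hne : Nonempty ι := Fintype.card_pos_iff.1 (Nat.pos_of_ne_zero fun h0 ↦ by
    rw [h0, Nat.cast_zero] at hcard; linarith)
  obtain ⟨v, hv, hvx⟩ := hu.exists_frame_apply_eq hcV (Classical.arbitrary ι) hx hB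
  have hmul (φ ψ : V →ₗ[ℝ] ℝ) : ∑ i, φ (v i) * ψ (v i) = ∑ i, φ (u i) * ψ (u i) :=
    hu.trace_eq hv (LinearMap.mk₂ ℝ (fun x y ↦ φ x * ψ y)
      (fun _ _ _ ↦ by rw [map_add, add_mul]) (fun _ _ _ ↦ by rw [map_smul, smul_mul_assoc])
      (fun _ _ _ ↦ by rw [map_add, mul_add]) (fun _ _ _ ↦ by rw [map_smul, mul_smul_comm])) hB
  have key := H.oprea_le (fun i j ↦ by rw [← hBg, hv.apply_eq]) hc hn hcard
    (Classical.arbitrary ι) hξ a b c hα hβ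
  -- The last `c`-term is the squared norm of this single 1-form, hence also a trace.
  have hw := hmul (α x • β - β x • α) (α x • β - β x • α)
  simp only [LinearMap.sub_apply, LinearMap.smul_apply, smul_eq_mul] at hw
  rwa [hvx, H.sum_gaussForm_eq hu hv hB, hu.trace_eq hv (gaussForm g L h a b c α β x) hB,
    hmul, hmul, hmul, hw, hu.trace_eq hv h hB] at key

end IsLagrangianSff

/-- Oprea's invariant for `k = dim N` involves a single Ricci curvature. -/
theorem opreaDelta_eq {E : Type*} [NormedAddCommGroup E] [NormedSpace ℝ E]
    {M : Type*} [TopologicalSpace M] [ChartedSpace E M]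
    {g : ∀ x : M, TangentSpace 𝓘(ℝ, E) x →L[ℝ] TangentSpace 𝓘(ℝ, E) x →L[ℝ] ℝ} {p : M}
    {m : ℕ} {e : Fin m → TangentSpace 𝓘(ℝ, E) p} (he : IsFrame (g p).toLinearMap₁₂ e)
    {x : TangentSpace 𝓘(ℝ, E) p} (hx : g p x x = 1)
    (hmin : ∀ y, g p y y = 1 → ricci g p e x ≤ ricci g p e y)
    (htr : ∀ l : Fin m → TangentSpace 𝓘(ℝ, E) p, IsOrthonormal g p l →
      ∀ y, ricci g p l y = ricci g p e y) :
    opreaDelta g p e m = scalarCurvature g p e - 1 / ((m : ℝ) - 1) * ricci g p e x := by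
  unfold opreaDelta
  congr 2
  refine IsLeast.csInf_eq ⟨⟨e, he.apply_eq, x, ?_, hx, rfl⟩, ?_⟩
  · rw [he.expand x]
    exact Submodule.sum_mem _ fun i _ ↦ Submodule.smul_mem _ _ (Submodule.subset_span ⟨i, rfl⟩)
  · rintro r ⟨l, hl, y, -, hy, rfl⟩
    rw [htr l hl]
    exact hmin y hy

end QCH

open QCH
theorem theorem5p2 {n : ℕ} (hn : 3 ≤ n)
    {M : Type*} [TopologicalSpace M] [ChartedSpace (EuclideanSpace ℝ (Fin (2 * n))) M]
    [IsManifold (𝓡 (2 * n)) ∞ M]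
    (g : Bundle.ContMDiffRiemannianMetric (𝓡 (2 * n)) ∞ (EuclideanSpace ℝ (Fin (2 * n)))
      (fun x : M ↦ TangentSpace (𝓡 (2 * n)) x))
    (J : ∀ x : M, TangentSpace (𝓡 (2 * n)) x →L[ℝ] TangentSpace (𝓡 (2 * n)) x)
    (D : ∀ x : M, Submodule ℝ (TangentSpace (𝓡 (2 * n)) x))
    (hK : IsKaehler g J) (hD : IsHolomorphicDistribution g J D) (hQ : IsQCH g J D) :
    (∃ a b c : M → ℝ, HasCurvatureFunctions g J D a b c) ∧
    ∀ a b c : M → ℝ, HasCurvatureFunctions g J D a b c →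
    ∀ {N : Type*} [TopologicalSpace N] [ChartedSpace (EuclideanSpace ℝ (Fin n)) N]
      [IsManifold (𝓡 n) ∞ N] (f : N → M), IsLagrangianImmersion (E' := EuclideanSpace ℝ (Fin n)) g.inner J f →
    ∀ (q : N) (e : Fin n → TangentSpace (𝓡 n) q), IsOrthonormal (inducedMetric g.inner f) q e →
    (∃ X : TangentSpace (𝓡 n) q, inducedMetric g.inner f q X X = 1 ∧
      ∀ Y : TangentSpace (𝓡 n) q, inducedMetric g.inner f q Y Y = 1 →
        ricci (inducedMetric g.inner f) q e X ≤ ricci (inducedMetric g.inner f) q e Y) ∧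
    ∀ X : TangentSpace (𝓡 n) q, inducedMetric g.inner f q X X = 1 →
      (∀ Y : TangentSpace (𝓡 n) q, inducedMetric g.inner f q Y Y = 1 →
        ricci (inducedMetric g.inner f) q e X ≤ ricci (inducedMetric g.inner f) q e Y) →
    ∀ ξ : TangentSpace (𝓡 (2 * n)) (f q), IsUnitNormal g D (f q) ξ →
    ∀ η η' : TangentSpace (𝓡 n) q → ℝ,
      η = tangential f q (eta g ξ) → η' = tangential f q (eta g (J (f q) ξ)) →
    opreaDelta (inducedMetric g.inner f) q e n ≤
      ((n : ℝ) - 2) * (n + 1) / 8 * a (f q)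
      + ((n : ℝ) - 2) / (8 * (n - 1)) * (n - (η X ^ 2 + η' X ^ 2)) * b (f q)
      + (formInner e η η * formInner e η' η' - formInner e η η' ^ 2
          - 1 / ((n : ℝ) - 1) * formInner e (η X • η' - η' X • η) (η X • η' - η' X • η)) * c (f q)
      + (3 * (n : ℝ) - 1) * (n - 2) * n ^ 2 / (2 * (n - 1) * (3 * n + 5))
        * g.inner (f q) (meanCurvature g.inner f q e) (meanCurvature g.inner f q e) := by
  have hfin (m : ℕ) : m = Module.finrank ℝ (EuclideanSpace ℝ (Fin m)) :=
    finrank_euclideanSpace_fin.symm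
  refine ⟨exists_hasCurvatureFunctions ((hfin (2 * n)) ▸ (by omega)) hK hD hQ, ?_⟩
  intro a b c hR N _ _ _ f hf q e he
  have hne : Nonempty (Fin n) := ⟨⟨0, by omega⟩⟩
  have hcV : Fintype.card (Fin n) = Module.finrank ℝ (TangentSpace (𝓡 n) q) :=
    (Fintype.card_fin n).trans (hfin n)
  have hcW : 2 * Fintype.card (Fin n) = Module.finrank ℝ (TangentSpace (𝓡 (2 * n)) (f q)) :=
    (congrArg (2 * ·) (Fintype.card_fin n)).trans (hfin (2 * n))
  have H := hf.isLagrangianSff hK q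
  let B := (inducedMetric (E' := EuclideanSpace ℝ (Fin n)) g.inner f q).toLinearMap₁₂
  have hB : ∀ x y, B x y = B y x := fun x y ↦ g.symm (f q) _ _
  have heB : IsFrame B e := isFrame_of_card he hcV
  let α (ξ : TangentSpace (𝓡 (2 * n)) (f q)) : TangentSpace (𝓡 n) q →ₗ[ℝ] ℝ :=
    ((g.inner (f q) ξ).comp (mfderiv (𝓡 n) (𝓡 (2 * n)) f q)).toLinearMap
  let G (ξ : TangentSpace (𝓡 (2 * n)) (f q)) := gaussForm (g.inner (f q)).toLinearMap₁₂
    (mfderiv (𝓡 n) (𝓡 (2 * n)) f q).toLinearMap (sffMap (E' := EuclideanSpace ℝ (Fin n)) g f q)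
    (a (f q)) (b (f q)) (c (f q))
    (α ξ) (α (J (f q) ξ))
  have hriem {ξ} (hξ : IsUnitNormal g D (f q) ξ) (u v : TangentSpace (𝓡 n) q) :
      riemann (inducedMetric g.inner f) q u v v u = G ξ u v v :=
    hf.riemann_eq_gaussForm hR q hξ u v v
  have hric {ξ} (hξ : IsUnitNormal g D (f q) ξ) (l : Fin n → TangentSpace (𝓡 n) q)
      (x : TangentSpace (𝓡 n) q) :
      ricci (inducedMetric g.inner f) q l x = ∑ i, G ξ x (l i) (l i) :=
    Finset.sum_congr rfl fun i _ ↦ hriem hξ x (l i)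
  refine ⟨?_, ?_⟩
  -- A unit normal at `f q`, needed to express the Ricci curvature by `gaussForm`, comes from the
  -- local section spanning `D^⊥`.
  · obtain ⟨ξ, U, hU, -, hξ⟩ := hD.smooth (f q)
    have hξ := hξ _ (mem_of_mem_nhds hU)
    -- By pair symmetry `Ric(x) = ∑ G(e_i)(x, x)`, which exhibits the Ricci curvature as the
    -- diagonal of a bilinear form.
    obtain ⟨X, hX, hmin⟩ := heB.exists_forall_le (∑ i, G (ξ (f q)) (e i))
    have hr (x : TangentSpace (𝓡 n) q) : ricci (inducedMetric g.inner f) q e x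
        = (∑ i, G (ξ (f q)) (e i)) x x := by
      rw [hric hξ, LinearMap.sum_apply, LinearMap.sum_apply]
      exact Finset.sum_congr rfl fun i _ ↦ H.gaussForm_symm ..
    refine ⟨X, hX, fun Y hY ↦ ?_⟩
    rw [hr, hr]
    exact hmin Y hY
  · rintro X hX hmin ξ hξ η η' rfl rfl
    have htr (l : Fin n → TangentSpace (𝓡 n) q) (hl : IsOrthonormal (inducedMetric g.inner f) q l)
        (y : TangentSpace (𝓡 n) q) : ricci (inducedMetric g.inner f) q l y
          = ricci (inducedMetric g.inner f) q e y := by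
      rw [hric hξ, hric hξ]
      exact heB.trace_eq (isFrame_of_card hl hcV) (G ξ y) hB
    have hscal : scalarCurvature (inducedMetric g.inner f) q e
        = 1 / 2 * ∑ i, ∑ j, G ξ (e i) (e j) (e j) := by
      rw [← sum_lt_eq_half_sum _ (fun i j ↦ H.gaussForm_symm ..) (fun i ↦ gaussForm_self ..)]
      exact Finset.sum_congr rfl fun i _ ↦ Finset.sum_congr rfl fun j _ ↦ by rw [hriem hξ]
    have hH : meanCurvature g.inner f q e = (1 / (n : ℝ)) • ∑ i, sffMap (E' := EuclideanSpace ℝ (Fin n)) g f q (e i) (e i) := by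
      simp only [meanCurvature, sffMap_apply]
    have hn0 : (n : ℝ) ≠ 0 := by positivity
    have key := H.oprea_le_of_unit (fun _ _ ↦ rfl) heB hcV hcW (n := n) (by exact_mod_cast hn)
      (by simp) hX hξ.1 (a (f q)) (b (f q)) (c (f q)) (α := α ξ) (β := α (J (f q) ξ))
      (fun _ ↦ rfl) (fun _ ↦ rfl)
    rw [opreaDelta_eq heB hX hmin htr, hscal, hric hξ, hH]
    -- Only the last term differs: the trace of `h` is `n H`, which accounts for the factor `n²`.
    refine key.trans (le_of_eq (congrArg₂ (· + ·) rfl ?_))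
    simp only [map_smul, smul_apply, smul_eq_mul, ContinuousLinearMap.toLinearMap₁₂_apply_apply_apply]
    field_simp
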